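/- Let $F$ be a global field (a number field or a finite extension of $\mathbb{F}_p(t)$ for a prime $p$), let $F^s$ be a separable closure of $F$ and $G_F=\mathrm{Gal}(F^s/F)$. For each place $v$ of $F$ fix a place of $F^s$ above $v$; let $G_v\le G_F$ be its decomposition group and $I_v\le G_v$ its inertia group, with $I_v=G_v$ if $v$ is archimedean. For a finite discrete $G_F$-module $M$, let $H^1(G_v,M)$ be continuous cohomology with the discrete topology, and put $H^1_{\mathrm{ur}}(G_v,M)=\ker\big(H^1(G_v,M)\to H^1(I_v,M)\big)$. Let $\prod'_v H^1(G_v,M)$ be the restricted product over all places $v$ of $F$ with respect to the subgroups $H^1_{\mathrm{ur}}(G_v,M)$, with the restricted product topology. Let $\mathrm{SMod}_F$ be the category whose objects are pairs $(M,\mathscr{W})$, where $M$ is a finite discrete $G_F$-module whose order is not divisible by the characteristic of $F$ and $\mathscr{W}$ is a compact open subgroup of $\prod'_v H^1(G_v,M)$, and whose morphisms $(M,\mathscr{W})\to(M',\mathscr{W}')$ are the $G_F$-equivariant homomorphisms $f\colon M\to M'$ with $f(\mathscr{W})\subseteq\mathscr{W}'$. A sequence $$0\to(M_1,\mathscr{W}_1)\xrightarrow{\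 \iota\ }(M,\mathscr{W})\xrightarrow{\ \pi\ }(M_2,\mathscr{W}_2)\to 0$$ in $\mathrm{SMod}_F$ is called short exact if the underlying sequence of $G_F$-modules is exact, $\iota^{-1}(\mathscr{W})=\mathscr{W}_1$ and $\pi(\mathscr{W})=\mathscr{W}_2$. Then $\mathrm{SMod}_F$ is quasi-abelian: it is an additive category with all kernels and cokernels, any pullback of a strict epimorphism (a morphism that is a cokernel) is a strict epimorphism, and any pushout of a strict monomorphism (a morphism that is a kernel) is a strict monomorphism. Moreover, for every short exact sequence $0\to M_1\xrightarrow{\iota}M\xrightarrow{\pi}M_2\to0$ in $\mathrm{SMod}_F$ (local conditions suppressed): 1. For every morphism $f\colon N_2\to M_2$ in $\mathrm{SMod}_F$, a pullback of $\pi$ and $f$ exists. For any such pullback $N$, with projections $p\colon N\to M$ and $\pi_N\colon N\to N_2$, there is a unique morphism $\iota_N\colon M_1\to N$ with $p\circ\iota_N=\iota$ and $\pi_N\circ\iota_N=0$, and $0\to M_1\xrightarrow{\iota_N}N\xrightarrow{\pi_N}N_2\to0$ is short exact in $\mathrm{SMod}_F$. 2. For every morphism $g\colon M_1\to N_1$ in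 $\mathrm{SMod}_F$, a pushout of $\iota$ and $g$ exists. For any such pushout $N$, with maps $q\colon M\to N$ and $\iota_N\colon N_1\to N$, there is a unique morphism $\pi_N\colon N\to M_2$ with $\pi_N\circ q=\pi$ and $\pi_N\circ\iota_N=0$, and $0\to N_1\xrightarrow{\iota_N}N\xrightarrow{\pi_N}M_2\to0$ is short exact in $\mathrm{SMod}_F$. -/

import Mathlib

universe u v w

open CategoryTheory CategoryTheory.Limits
open scoped RestrictedProduct

namespace Selmerable

noncomputable section

/-! ### Continuous first cohomology with inhomogeneous cochains -/

section Cohomology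

variable (Γ : Type*) [Group Γ] [TopologicalSpace Γ]

/-- The group `Z¹(Γ, M)` of continuous inhomogeneous 1-cocycles. -/
def Z1 (M : Type*) [AddCommGroup M] [TopologicalSpace M] [DiscreteTopology M]
    [DistribMulAction Γ M] : AddSubgroup (Γ → M) where
  carrier := {f | Continuous f ∧ ∀ σ τ : Γ, f (σ * τ) = f σ + σ • f τ}
  zero_mem' := ⟨continuous_const, by simp⟩
  add_mem' := by
    rintro f g ⟨hf, hf'⟩ ⟨hg, hg'⟩
    refine ⟨hf.add hg, fun σ τ => ?_⟩
    simp only [Pi.add_apply, hf', hg', smul_add]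
    abel
  neg_mem' := by
    rintro f ⟨hf, hf'⟩
    refine ⟨hf.neg, fun σ τ => ?_⟩
    simp only [Pi.neg_apply, hf', smul_neg]
    abel

variable (M : Type*) [AddCommGroup M] [TopologicalSpace M] [DiscreteTopology M]
  [DistribMulAction Γ M] [ContinuousSMul Γ M]

/-- The coboundary map `M = C⁰(Γ, M) → Z¹(Γ, M)`, sending `m` to `σ ↦ σ m - m`. -/
def coboundary : M →+ Z1 Γ M where
  toFun m := ⟨fun σ => σ • m - m,
    (continuous_id.smul continuous_const).sub continuous_const, fun σ τ => by
      simp only [mul_smul, smul_sub]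
      abel⟩
  map_zero' := by ext; simp
  map_add' a b := by
    ext σ
    simp only [smul_add, AddSubgroup.coe_add, Pi.add_apply]
    abel

/-- The continuous cohomology group `H¹(Γ, M) = Z¹(Γ, M) / B¹(Γ, M)`. -/
def H1 : Type _ := Z1 Γ M ⧸ (coboundary Γ M).range

instance : AddCommGroup (H1 Γ M) :=
  inferInstanceAs (AddCommGroup (Z1 Γ M ⧸ (coboundary Γ M).range))

/-- Cohomology groups carry the discrete topology. -/
instance : TopologicalSpace (H1 Γ M) := ⊥

instance : DiscreteTopology (H1 Γ M) := ⟨rfl⟩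

variable {M}

/-- The class of a cocycle. -/
def H1.mk : Z1 Γ M →+ H1 Γ M := QuotientAddGroup.mk' (coboundary Γ M).range

variable {Γ}

theorem H1.induction_on {p : H1 Γ M → Prop} (x : H1 Γ M) (h : ∀ z, p (H1.mk Γ z)) : p x :=
  QuotientAddGroup.induction_on x h

/-- Restriction `H¹(Γ, M) → H¹(K, M)` to a subgroup `K` of `Γ`. -/
def H1.res (K : Subgroup Γ) : H1 Γ M →+ H1 K M :=
  QuotientAddGroup.map _ _
    ({ toFun := fun z => ⟨fun σ => z.1 σ, z.2.1.comp continuous_subtype_val,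
          fun σ τ => z.2.2 σ τ⟩
       map_zero' := rfl
       map_add' := fun _ _ => rfl } : Z1 Γ M →+ Z1 K M)
    (by
      rintro _ ⟨m, rfl⟩
      exact ⟨m, rfl⟩)

variable {N : Type*} [AddCommGroup N] [TopologicalSpace N] [DiscreteTopology N]
  [DistribMulAction Γ N] [ContinuousSMul Γ N]

/-- The map `Z¹(Γ, M) → Z¹(Γ, N)` induced by a `Γ`-equivariant homomorphism `M → N`. -/
def Z1.map (f : M →+ N) (hf : ∀ (σ : Γ) (m : M), f (σ • m) = σ • f m) : Z1 Γ M →+ Z1 Γ N where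
  toFun z := ⟨fun σ => f (z.1 σ), continuous_of_discreteTopology.comp z.2.1,
    fun σ τ => by simp only [z.2.2 σ τ, map_add, hf]⟩
  map_zero' := by ext; simp
  map_add' a b := by ext; simp

/-- The map `H¹(Γ, M) → H¹(Γ, N)` induced by a `Γ`-equivariant homomorphism `M → N`. -/
def H1.map (f : M →+ N) (hf : ∀ (σ : Γ) (m : M), f (σ • m) = σ • f m) : H1 Γ M →+ H1 Γ N :=
  QuotientAddGroup.map _ _ (Z1.map f hf) (by
    rintro _ ⟨m, rfl⟩
    exact ⟨f m, by ext σ; simp [coboundary, Z1.map, hf]⟩)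

theorem H1.map_mk (f : M →+ N) (hf : ∀ (σ : Γ) (m : M), f (σ • m) = σ • f m) (z : Z1 Γ M) :
    H1.map f hf (H1.mk Γ z) = H1.mk Γ (Z1.map f hf z) := rfl

theorem H1.res_map (K : Subgroup Γ) (f : M →+ N) (hf : ∀ (σ : Γ) (m : M), f (σ • m) = σ • f m)
    (x : H1 Γ M) :
    H1.res K (H1.map f hf x) = H1.map (Γ := K) f (fun σ m => hf σ m) (H1.res K x) := by
  induction x using H1.induction_on
  rfl

end Cohomology

/-! ### Global fields, places, decomposition and inertia groups -/

/-- A global field is a number field or a finite extension of `𝔽_p(t)` for a prime `p`. -/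
def IsGlobalField (F : Type u) [Field F] : Prop :=
  NumberField F ∨ ∃ (p : ℕ) (_ : Fact p.Prime) (_ : Algebra (RatFunc (ZMod p)) F),
    FunctionField (ZMod p) F

/-- The places of a global field `K`, or of a separable algebraic extension `K` of one. The
archimedean ones are the absolute values coming from complex embeddings (there are none in
positive characteristic), and the nonarchimedean ones are given by the nontrivial valuation
rings of `K`. -/
inductive Place (K : Type u) [Field K] : Type u
  | archimedean (w : NumberField.InfinitePlace K) : Place K
  | nonarchimedean (A : ValuationSubring K) (hA : A ≠ ⊤) : Place K

section Places

variable {F : Type u} [Field F] {Fs : Type v} [Field Fs] [Algebra F Fs]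

/-- The place `w` of `Fs` restricts to the place `v` of `F`. -/
def Place.LiesOver : Place Fs → Place F → Prop
  | .archimedean w, .archimedean v => w.comap (algebraMap F Fs) = v
  | .nonarchimedean B _, .nonarchimedean A _ => B.comap (algebraMap F Fs) = A
  | _, _ => False

variable (F) in
/-- The decomposition group in `Gal(Fs/F)` of a place of `Fs`. -/
def Place.decompositionGroup : Place Fs → Subgroup Gal(Fs/F)
  | .archimedean w => MulAction.stabilizer Gal(Fs/F) w
  | .nonarchimedean B _ => B.decompositionSubgroup F

variable (F) in
/-- The inertia group of a place of `Fs`, as a subgroup of the decomposition group. It is the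
whole decomposition group at archimedean places. -/
def Place.inertiaGroup : (w : Place Fs) → Subgroup (w.decompositionGroup F)
  | .archimedean _ => ⊤
  | .nonarchimedean B _ => B.inertiaSubgroup F

variable (F Fs) in
/-- A choice, for each place `v` of `F`, of a place of `Fs` above it. This is the same as fixing
embeddings `Fs → F_v^s` up to automorphisms of `F_v^s`, and realizes the local Galois groups as
subgroups of `Gal(Fs/F)`. -/
structure PlaceExtension where
  toFun : Place F → Place Fs
  liesOver : ∀ v, (toFun v).LiesOver v

variable (P : PlaceExtension F Fs)

/-- The group `G_v`. -/
abbrev PlaceExtension.G (v : Place F) : Subgroup Gal(Fs/F) := (P.toFun v).decompositionGroup F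

/-- The group `I_v`. -/
abbrev PlaceExtension.I (v : Place F) : Subgroup (P.G v) := (P.toFun v).inertiaGroup F

end Places

/-! ### The restricted product of local cohomology groups -/

section Local

variable {F : Type u} [Field F] {Fs : Type v} [Field Fs] [Algebra F Fs]
  (P : PlaceExtension F Fs)
  (M : Type w) [AddCommGroup M] [TopologicalSpace M] [DiscreteTopology M]
  [DistribMulAction Gal(Fs/F) M] [ContinuousSMul Gal(Fs/F) M]

/-- The subgroup `H¹_ur(G_v, M)` of classes with trivial restriction to `I_v`. -/
def unramified (v : Place F) : AddSubgroup (H1 (P.G v) M) := (H1.res (P.I v)).ker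

/-- The restricted product over all places `v` of `H¹(G_v, M)` with respect to `H¹_ur(G_v, M)`,
with the restricted product topology. -/
abbrev LocalH1 : Type _ := Πʳ v : Place F, [H1 (P.G v) M, unramified P M v]

variable {M}
variable {N : Type*} [AddCommGroup N] [TopologicalSpace N] [DiscreteTopology N]
  [DistribMulAction Gal(Fs/F) N] [ContinuousSMul Gal(Fs/F) N]

/-- The map between restricted products induced by an equivariant homomorphism. -/
def localMap (f : M →+ N) (hf : ∀ (σ : Gal(Fs/F)) (m : M), f (σ • m) = σ • f m) :
    LocalH1 P M →+ LocalH1 P N :=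
  RestrictedProduct.mapAlongAddMonoidHom _ _ id Filter.tendsto_id
    (fun v => H1.map (Γ := P.G v) f (fun σ m => hf σ m))
    (Filter.Eventually.of_forall fun v x hx => by
      change H1.res _ (H1.map _ _ x) = 0
      rw [H1.res_map, show H1.res (P.I v) x = 0 from hx, map_zero])

theorem localMap_apply (f : M →+ N) (hf : ∀ (σ : Gal(Fs/F)) (m : M), f (σ • m) = σ • f m)
    (x : LocalH1 P M) (v : Place F) :
    localMap P f hf x v = H1.map (Γ := P.G v) f (fun σ m => hf σ m) (x v) := rfl

end Local

/-! ### The category of Selmerable modules -/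

section Category

variable {F : Type u} [Field F] {Fs : Type v} [Field Fs] [Algebra F Fs]

/-- An object of `SMod_F`: a finite discrete `Gal(Fs/F)`-module of order indivisible by the
characteristic of `F`, with a compact open subgroup of the restricted product of its local
cohomology groups. -/
structure SMod (P : PlaceExtension F Fs) : Type (max u v (w + 1)) where
  carrier : Type w
  [addCommGroup : AddCommGroup carrier]
  [topologicalSpace : TopologicalSpace carrier]
  [discreteTopology : DiscreteTopology carrier]
  [distribMulAction : DistribMulAction Gal(Fs/F) carrier]
  [continuousSMul : ContinuousSMul Gal(Fs/F) carrier]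
  [finite : Finite carrier]
  not_dvd_card : ¬ ringChar F ∣ Nat.card carrier
  /-- the local conditions subgroup -/
  W : AddSubgroup (LocalH1 P carrier)
  isCompact : IsCompact (W : Set (LocalH1 P carrier))
  isOpen : IsOpen (W : Set (LocalH1 P carrier))

attribute [instance] SMod.addCommGroup SMod.topologicalSpace SMod.discreteTopology
  SMod.distribMulAction SMod.continuousSMul SMod.finite

variable {P : PlaceExtension F Fs}

namespace SMod

/-- A morphism of `SMod_F`: an equivariant homomorphism carrying `X.W` into `Y.W`. -/
@[ext]
structure Hom (X Y : SMod.{u, v, w} P) : Type w where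
  hom : X.carrier →+ Y.carrier
  map_smul : ∀ (σ : Gal(Fs/F)) (m : X.carrier), hom (σ • m) = σ • hom m
  map_W : ∀ φ ∈ X.W, localMap P hom map_smul φ ∈ Y.W

theorem localMap_id (X : SMod.{u, v, w} P) (φ : LocalH1 P X.carrier) :
    localMap P (AddMonoidHom.id X.carrier) (fun _ _ => rfl) φ = φ := by
  ext v
  rw [localMap_apply]
  induction φ v using H1.induction_on
  rfl

theorem localMap_comp {X Y Z : SMod.{u, v, w} P} (f : X.carrier →+ Y.carrier)
    (hf : ∀ (σ : Gal(Fs/F)) (m : X.carrier), f (σ • m) = σ • f m) (g : Y.carrier →+ Z.carrier)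
    (hg : ∀ (σ : Gal(Fs/F)) (m : Y.carrier), g (σ • m) = σ • g m) (φ : LocalH1 P X.carrier) :
    localMap P (g.comp f) (fun σ m => by simp [hf, hg]) φ =
      localMap P g hg (localMap P f hf φ) := by
  ext v
  rw [localMap_apply, localMap_apply, localMap_apply]
  induction φ v using H1.induction_on
  rfl

theorem localMap_zero (X Y : SMod.{u, v, w} P) (φ : LocalH1 P X.carrier) :
    localMap P (0 : X.carrier →+ Y.carrier) (fun _ _ => by simp) φ = 0 := by
  ext v
  rw [localMap_apply]
  induction φ v using H1.induction_on
  rfl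

theorem localMap_add {X Y : SMod.{u, v, w} P} (f g : X.carrier →+ Y.carrier)
    (hf : ∀ (σ : Gal(Fs/F)) (m : X.carrier), f (σ • m) = σ • f m)
    (hg : ∀ (σ : Gal(Fs/F)) (m : X.carrier), g (σ • m) = σ • g m) (φ : LocalH1 P X.carrier) :
    localMap P (f + g) (fun σ m => by simp [hf, hg]) φ =
      localMap P f hf φ + localMap P g hg φ := by
  ext v
  rw [RestrictedProduct.add_apply, localMap_apply, localMap_apply, localMap_apply]
  induction φ v using H1.induction_on
  rfl

theorem localMap_neg {X Y : SMod.{u, v, w} P} (f : X.carrier →+ Y.carrier)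
    (hf : ∀ (σ : Gal(Fs/F)) (m : X.carrier), f (σ • m) = σ • f m) (φ : LocalH1 P X.carrier) :
    localMap P (-f) (fun σ m => by simp [hf]) φ = - localMap P f hf φ := by
  ext v
  rw [RestrictedProduct.neg_apply, localMap_apply, localMap_apply]
  induction φ v using H1.induction_on
  rfl

instance : Category.{w} (SMod.{u, v, w} P) where
  Hom := Hom
  id X := ⟨AddMonoidHom.id _, fun _ _ => rfl, fun φ hφ => by rwa [localMap_id]⟩
  comp f g := ⟨g.hom.comp f.hom, fun σ m => by simp [f.map_smul, g.map_smul], fun φ hφ => by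
    rw [localMap_comp _ f.map_smul _ g.map_smul]
    exact g.map_W _ (f.map_W _ hφ)⟩

variable {X Y : SMod.{u, v, w} P}

instance : Zero (X ⟶ Y) :=
  ⟨⟨0, fun _ _ => by simp, fun φ _ => by rw [localMap_zero]; exact zero_mem _⟩⟩

instance : Add (X ⟶ Y) :=
  ⟨fun f g => ⟨f.hom + g.hom, fun σ m => by simp [f.map_smul, g.map_smul], fun φ hφ => by
    rw [localMap_add _ _ f.map_smul g.map_smul]
    exact add_mem (f.map_W _ hφ) (g.map_W _ hφ)⟩⟩

instance : Neg (X ⟶ Y) :=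
  ⟨fun f => ⟨-f.hom, fun σ m => by simp [f.map_smul], fun φ hφ => by
    rw [localMap_neg _ f.map_smul]
    exact neg_mem (f.map_W _ hφ)⟩⟩

instance : AddCommGroup (X ⟶ Y) where
  add_assoc _ _ _ := Hom.ext (add_assoc _ _ _)
  zero_add _ := Hom.ext (zero_add _)
  add_zero _ := Hom.ext (add_zero _)
  add_comm _ _ := Hom.ext (add_comm _ _)
  neg_add_cancel _ := Hom.ext (neg_add_cancel _)
  nsmul := nsmulRec
  zsmul := zsmulRec

/-- Morphisms are added pointwise. -/
instance : Preadditive (SMod.{u, v, w} P) where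
  add_comp _ _ _ _ _ _ := Hom.ext (AddMonoidHom.comp_add _ _ _)
  comp_add _ _ _ _ _ _ := Hom.ext (AddMonoidHom.add_comp _ _ _)

/-- The map `∏' H¹(G_v, X) → ∏' H¹(G_v, Y)` induced by a morphism. -/
def locMap (f : X ⟶ Y) : LocalH1 P X.carrier →+ LocalH1 P Y.carrier :=
  localMap P f.hom f.map_smul

/-- The sequence `0 → M₁ → M → M₂ → 0` is short exact in `SMod_F`: it is a short exact sequence
of Galois modules, the preimage of `M.W` is `M₁.W`, and the image of `M.W` is `M₂.W`. -/
structure ShortExact {M₁ M M₂ : SMod.{u, v, w} P} (ι : M₁ ⟶ M) (π : M ⟶ M₂) : Prop where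
  injective : Function.Injective ι.hom
  exact : ∀ m : M.carrier, π.hom m = 0 ↔ ∃ m₁ : M₁.carrier, ι.hom m₁ = m
  surjective : Function.Surjective π.hom
  comap_W : M.W.comap (locMap ι) = M₁.W
  map_W : M.W.map (locMap π) = M₂.W

end SMod

end Category

/-! ### Quasi-abelian categories -/

section QuasiAbelian

variable {C : Type*} [Category C] [Preadditive C]

/-- A strict monomorphism is a kernel of some morphism. -/
def IsStrictMono {X Y : C} (f : X ⟶ Y) : Prop :=
  ∃ (Z : C) (g : Y ⟶ Z) (h : f ≫ g = 0), Nonempty (IsLimit (KernelFork.ofι f h))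

/-- A strict epimorphism is a cokernel of some morphism. -/
def IsStrictEpi {X Y : C} (f : X ⟶ Y) : Prop :=
  ∃ (Z : C) (g : Z ⟶ X) (h : g ≫ f = 0), Nonempty (IsColimit (CokernelCofork.ofπ f h))

variable (C) in
/-- A quasi-abelian category: an additive category with all kernels and cokernels, in which
strict epimorphisms are stable under pullback and strict monomorphisms under pushout. -/
structure IsQuasiAbelian : Prop where
  hasFiniteBiproducts : HasFiniteBiproducts C
  hasKernels : HasKernels C
  hasCokernels : HasCokernels C
  isStrictEpi_of_isPullback : ∀ {X' Y' X Y : C} (p : X' ⟶ X) (f' : X' ⟶ Y') (f : X ⟶ Y)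
    (g : Y' ⟶ Y), IsPullback p f' f g → IsStrictEpi f → IsStrictEpi f'
  isStrictMono_of_isPushout : ∀ {X Y X' Y' : C} (f : X ⟶ Y) (g : X ⟶ X') (q : Y ⟶ Y')
    (f' : X' ⟶ Y'), IsPushout f g q f' → IsStrictMono f → IsStrictMono f'

end QuasiAbelian

end

end Selmerable

/-! ### Valuation subrings in algebraic field extensions -/

namespace ValuationSubring

open IsLocalRing Polynomial

variable {K L : Type*} [Field K] [Field L] [Algebra K L]

/-! Fibre products of Galois modules get the intersection of the preimages of the local conditions,
and quotients get the image. Once these subgroups are known to be compact and open, the universal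
properties are formal. Strict monomorphisms are then the injections whose source carries the
preimage of the local conditions, and strict epimorphisms the surjections whose target carries the
image: they are the two maps of short exact sequences. Quasi-abelianness thus follows from the
stability of short exact sequences under pullback and pushout.

Two topological facts carry the constructions. A joint preimage of compact open subgroups under
jointly injective maps is compact (`isCompact_comap_localMap`): it is closed in a box whose local
factors are finite and almost everywhere unramified. The image of an open subgroup under a
surjection of coefficients is open (`isOpen_map_localMap`): at almost all places unramified classes
lift to unramified classes, because G_v/I_v behaves like the profinite completion of ℤ
(`H1.exists_map_eq_of_hasFreeFrobenius`).

Behind both lie statements about almost all places, proved with valuation rings in place of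
completions. Every element of F lies in almost all valuation subrings, and the residue fields are
finite. A Bézout identity a f + b f' = 1 for the minimal polynomial f of a primitive element is
therefore integral at almost all places, and there it forces inertia to fix the root; so inertia
acts trivially on a given finite module. Finite residue fields provide a Frobenius element, and
roots of unity in the residue field of F^s show that its order is divisible by every integer.

Stability under pullback uses that H¹ of a fibre product surjects onto the fibre product of the H¹
(`exists_localMap_eq_of_fiberProduct`); stability under pushout uses exactness of H¹ in the middle
(`exists_localMap_eq_of_localMap_eq_zero`). In both cases the local lifts are automatically
unramified almost everywhere, hence assemble in the restricted product. -/

theorem isIntegral_of_forall_mem (A : ValuationSubring K) {y : L}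
    (h : ∀ V : ValuationSubring L, (∀ a ∈ A, algebraMap K L a ∈ V) → y ∈ V) :
    IsIntegral A y := by
  by_contra hy
  have hyR : y ∉ (integralClosure A L).toSubring := hy
  have : IsIntegrallyClosedIn (integralClosure A L).toSubring L :=
    inferInstanceAs (IsIntegrallyClosedIn (integralClosure A L) L)
  obtain ⟨V, hV, hyV⟩ := Subring.exists_le_valuationSubring_of_isIntegrallyClosedIn hyR
  exact hyV (h V fun a ha => hV ((integralClosure A L).algebraMap_mem ⟨a, ha⟩))

theorem mem_of_isIntegral {A : ValuationSubring K} {B : ValuationSubring L}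
    (h : ∀ a ∈ A, algebraMap K L a ∈ B) {y : L} (hy : IsIntegral A y) : y ∈ B := by
  obtain ⟨p, hp, hpy⟩ := hy
  let j : A →+* B :=
    ((algebraMap K L).comp A.subtype).codRestrict B.toSubring fun a => h a a.2
  have : IsIntegral B y := ⟨p.map j, hp.map j, by rw [eval₂_map]; exact hpy⟩
  obtain ⟨z, rfl⟩ := IsIntegrallyClosed.isIntegral_iff.mp this
  exact z.2

theorem mem_nonunits_comap {B : ValuationSubring L} {x : K} :
    x ∈ (B.comap (algebraMap K L)).nonunits ↔ algebraMap K L x ∈ B.nonunits := by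
  rcases eq_or_ne x 0 with rfl | hx
  · simp
  · rw [← inv_inv x, ValuationSubring.inv_mem_nonunits_iff, map_inv₀,
      ValuationSubring.inv_mem_nonunits_iff, mem_comap]
    simp [hx]

/-- If B contained K, it would contain everything integral over K, which is all of L. -/
theorem ne_top_of_comap [Algebra.IsAlgebraic K L] {B : ValuationSubring L} (hB : B ≠ ⊤) :
    B.comap (algebraMap K L) ≠ ⊤ := by
  intro h
  refine hB (top_unique fun y _ => ?_)
  refine mem_of_isIntegral (A := (⊤ : ValuationSubring K)) (fun a ha => ?_) ?_
  · rw [← mem_comap, h]; exact ha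
  · obtain ⟨p, hp, hpy⟩ := (Algebra.IsIntegral.isIntegral (R := K) y)
    let j : K →+* (⊤ : ValuationSubring K) := (RingHom.id K).codRestrict
      (⊤ : ValuationSubring K).toSubring fun _ => trivial
    exact ⟨p.map j, hp.map j, by rw [eval₂_map]; exact hpy⟩

/-- An element of a valuation subring `B` is a fraction of elements that are integral over the
valuation subring below, with a denominator that is a unit of `B`. -/
theorem exists_isIntegral_mul_eq [Algebra.IsAlgebraic K L] {B : ValuationSubring L} {x : L}
    (hx : x ∈ B) :
    ∃ b c : L, IsIntegral (B.comap (algebraMap K L)) b ∧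
      IsIntegral (B.comap (algebraMap K L)) c ∧ b ∉ B.nonunits ∧ b * x = c := by
  set A := B.comap (algebraMap K L) with hA
  rcases eq_or_ne x 0 with rfl | hx0
  · refine ⟨1, 0, isIntegral_one, isIntegral_zero, ?_, by simp⟩
    simp [ValuationSubring.mem_nonunits_iff]
  obtain ⟨P, hP0, hPx⟩ := Algebra.IsAlgebraic.isAlgebraic (R := K) x
  -- A coefficient of maximal valuation and, among those, of largest degree. After division by it
  -- all coefficients lie in A, and those of degree above j lie in the maximal ideal.
  obtain ⟨j, hj, hmax⟩ := Finset.exists_max_image P.support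
    (fun i => toLex (A.valuation (P.coeff i), i)) (Polynomial.nonempty_support_iff.mpr hP0)
  have hj0 : P.coeff j ≠ 0 := Polynomial.mem_support_iff.mp hj
  have hvj : A.valuation (P.coeff j) ≠ 0 := (A.valuation.ne_zero_iff).mpr hj0
  set q : ℕ → K := fun i => P.coeff i / P.coeff j with hq
  have hle : ∀ i ∈ P.support, q i ∈ A := fun i hi => by
    rw [← valuation_le_one_iff, map_div₀]
    refine div_le_one_of_le₀ ?_ zero_le
    have := Prod.Lex.toLex_le_toLex.mp (hmax i hi)
    rcases this with h | h
    exacts [h.le, h.1.le]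
  have hlt : ∀ i ∈ P.support, j < i → q i ∈ A.nonunits := fun i hi hji => by
    rw [ValuationSubring.mem_nonunits_iff, map_div₀]
    rw [div_lt_one₀ (zero_lt_iff.mpr hvj)]
    have := Prod.Lex.toLex_le_toLex.mp (hmax i hi)
    rcases this with h | h
    exacts [h, absurd h.2 (not_le.mpr hji)]
  -- The relation P(x) = 0, divided by the j-th coefficient, is cut at degree j: it reads x^j b +
  -- x^(j-1) d = 0, where b is a polynomial in x and d one in x⁻¹.
  set b : L := ∑ i ∈ P.support.filter (j ≤ ·), algebraMap K L (q i) * x ^ (i - j) with hb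
  set d : L := ∑ i ∈ P.support.filter (¬ j ≤ ·), algebraMap K L (q i) * x⁻¹ ^ (j - 1 - i) with hd
  have hbd : b * x = -d := by
    have h0 : ∑ i ∈ P.support, algebraMap K L (q i) * x ^ (i + 1) = 0 := by
      have : aeval x P = ∑ i ∈ P.support, algebraMap K L (P.coeff i) * x ^ i := by
        rw [aeval_eq_sum_range, ← Polynomial.sum_over_range' P (f := fun i a => a • x ^ i)
          (by simp) _ (Nat.lt_succ_self _), Polynomial.sum_def]
        simp [Algebra.smul_def]
      have h1 : ∑ i ∈ P.support, algebraMap K L (q i) * x ^ (i + 1) =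
          (algebraMap K L (P.coeff j))⁻¹ * x * aeval x P := by
        rw [this, Finset.mul_sum]
        refine Finset.sum_congr rfl fun i _ => ?_
        simp only [hq, map_div₀]
        ring
      rw [h1, hPx, mul_zero]
    rw [← Finset.sum_filter_add_sum_filter_not _ (j ≤ ·)] at h0
    have h2 : x ^ j * (b * x) + x ^ j * d = 0 := by
      rw [← h0, hb, hd, Finset.sum_mul, Finset.mul_sum, Finset.mul_sum]
      congr 1
      · refine Finset.sum_congr rfl fun i hi => ?_
        obtain ⟨k, rfl⟩ := Nat.exists_eq_add_of_le (Finset.mem_filter.mp hi).2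
        rw [Nat.add_sub_cancel_left]; ring
      · refine Finset.sum_congr rfl fun i hi => ?_
        have hij : i < j := not_le.mp (Finset.mem_filter.mp hi).2
        obtain ⟨k, rfl⟩ := Nat.exists_eq_add_of_lt hij
        rw [show i + k + 1 - 1 - i = k by omega, inv_pow]
        field_simp
        ring
    rw [← mul_add, mul_eq_zero] at h2
    exact eq_neg_of_add_eq_zero_left (h2.resolve_left (pow_ne_zero _ hx0))
  -- Integrality is tested on the valuation subrings V over A. If x lies in V, then so does b, and d
  -- = -bx; otherwise x⁻¹ lies in V, then so does d, and b = -dx⁻¹.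
  have key : ∀ V : ValuationSubring L, (∀ a ∈ A, algebraMap K L a ∈ V) → b ∈ V ∧ d ∈ V := by
    intro V hV
    rcases V.mem_or_inv_mem x with hxV | hxV
    · have hbV : b ∈ V := sum_mem fun i hi =>
        V.mul_mem _ _ (hV _ (hle i (Finset.mem_filter.mp hi).1)) (pow_mem hxV _)
      refine ⟨hbV, ?_⟩
      rw [← neg_neg d, ← hbd]
      exact NegMemClass.neg_mem (V.mul_mem _ _ hbV hxV)
    · have hdV : d ∈ V := sum_mem fun i hi =>
        V.mul_mem _ _ (hV _ (hle i (Finset.mem_filter.mp hi).1)) (pow_mem hxV _)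
      refine ⟨?_, hdV⟩
      rw [show b = -d * x⁻¹ by rw [← hbd]; field_simp]
      exact V.mul_mem _ _ (NegMemClass.neg_mem hdV) hxV
  refine ⟨b, -d, A.isIntegral_of_forall_mem fun V hV => (key V hV).1,
    (A.isIntegral_of_forall_mem fun V hV => (key V hV).2).neg, ?_, hbd⟩
  -- The terms above degree j are nonunits of B by the choice of j, so b is congruent to 1 modulo
  -- the maximal ideal.
  have hsplit : b = 1 + ∑ i ∈ P.support.filter (j < ·), algebraMap K L (q i) * x ^ (i - j) := by
    have : P.support.filter (j ≤ ·) = insert j (P.support.filter (j < ·)) := by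
      ext i
      simp only [Finset.mem_filter, Finset.mem_insert]
      constructor
      · rintro ⟨h1, h2⟩
        rcases h2.eq_or_lt with h | h
        exacts [Or.inl h.symm, Or.inr ⟨h1, h⟩]
      · rintro (rfl | h)
        exacts [⟨hj, le_rfl⟩, ⟨h.1, h.2.le⟩]
    rw [hb, this, Finset.sum_insert (by simp)]
    simp [hq, hj0]
  intro hbn
  have hs : ∑ i ∈ P.support.filter (j < ·), algebraMap K L (q i) * x ^ (i - j) ∈ B.nonunits := by
    refine sum_mem fun i hi => ?_
    obtain ⟨hi1, hi2⟩ := Finset.mem_filter.mp hi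
    have h1 := mem_nonunits_comap.mp (hlt i hi1 hi2)
    rw [ValuationSubring.mem_nonunits_iff] at h1 ⊢
    rw [map_mul]
    exact mul_lt_one_of_lt_of_le h1 ((B.valuation_le_one_iff _).mpr (pow_mem hx _))
  have h1 : (1 : L) ∈ B.nonunits := by
    rw [show (1 : L) = b - ∑ i ∈ P.support.filter (j < ·), algebraMap K L (q i) * x ^ (i - j) by
      rw [hsplit]; ring]
    exact sub_mem hbn hs
  simp [ValuationSubring.mem_nonunits_iff] at h1

/-- In an algebraic extension, a valuation subring is determined by its restriction and by its
center on the integral closure of that restriction. -/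
theorem le_of_center_le [Algebra.IsAlgebraic K L] {B B' : ValuationSubring L}
    (h : B.comap (algebraMap K L) = B'.comap (algebraMap K L))
    (hc : ∀ s : L, IsIntegral (B.comap (algebraMap K L)) s → s ∈ B'.nonunits → s ∈ B.nonunits) :
    B ≤ B' := by
  intro x hx
  obtain ⟨b, c, hb, hc', hbB, rfl⟩ := exists_isIntegral_mul_eq (K := K) hx
  have hsub : ∀ a ∈ B.comap (algebraMap K L), algebraMap K L a ∈ B' := fun a ha => by
    rw [h] at ha; exact ha
  have hb' : b ∉ B'.nonunits := fun hn => hbB (hc b hb hn)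
  have hb0 : b ≠ 0 := by rintro rfl; exact hbB (ZeroMemClass.zero_mem _)
  have hbi : b⁻¹ ∈ B' := by
    by_contra hn
    exact hb' (by rwa [← inv_inv b, ValuationSubring.inv_mem_nonunits_iff,
      or_iff_right (inv_ne_zero hb0)])
  have := B'.mul_mem _ _ hbi (mem_of_isIntegral hsub hc')
  rwa [inv_mul_cancel_left₀ hb0] at this

end ValuationSubring

/-! ### Finiteness of residue extensions and of the valuation subrings above a given one -/

namespace ValuationSubring

open IsLocalRing Polynomial

variable {K L : Type*} [Field K] [Field L] [Algebra K L]

/-- Lifts of linearly independent elements of a reduction are linearly independent. -/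
theorem finite_of_reduction {A : ValuationSubring K} {k : Type*} [Field k] (res : A →+* k)
    {V : Type*} [AddCommGroup V] [Module K V] [Module.Finite K V] [Module A V]
    [IsScalarTower A K V] {N : Type*} [AddCommGroup N] [Module A N] (i : N →ₗ[A] V)
    (hi : Function.Injective i) {Q : Type*} [AddCommGroup Q] [Module k Q] (q : N →+ Q)
    (hq : Function.Surjective q) (hqs : ∀ (a : A) (n : N), q (a • n) = res a • q n) :
    Module.Finite k Q := by
  let b := Module.Free.chooseBasis k Q
  choose n hn using fun j => hq (b j)
  have hli : LinearIndependent A (i ∘ n) := by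
    rw [linearIndependent_iff']
    intro s g hg
    by_contra! hne
    obtain ⟨j₀, hj₀, hgj₀⟩ := hne
    -- Dividing a relation by its coefficient of largest valuation gives a relation over A with one
    -- coefficient equal to 1, which reduces to a nontrivial relation over k.
    obtain ⟨j, hj, hmax⟩ := Finset.exists_max_image s (fun j => A.valuation (g j : K)) ⟨j₀, hj₀⟩
    have hgj : (g j : K) ≠ 0 := by
      intro h
      have h1 := hmax j₀ hj₀
      rw [h, map_zero, le_zero_iff, map_eq_zero] at h1
      exact hgj₀ (Subtype.ext h1)
    have hmem : ∀ l ∈ s, (g l : K) / g j ∈ A := fun l hl => by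
      rw [← valuation_le_one_iff, map_div₀]
      exact div_le_one_of_le₀ (hmax l hl) zero_le
    classical
    let h : _ → A := fun l => if hl : l ∈ s then ⟨_, hmem l hl⟩ else 0
    have hh : ∀ l ∈ s, g l = g j * h l := fun l hl => by
      ext
      simp only [h, dif_pos hl, MulMemClass.coe_mul]
      field_simp
    have h0 : i (∑ l ∈ s, h l • n l) = 0 := by
      have h1 : (g j : K) • i (∑ l ∈ s, h l • n l) = 0 := by
        rw [show (g j : K) • i (∑ l ∈ s, h l • n l) = g j • i (∑ l ∈ s, h l • n l) from
          (IsScalarTower.algebraMap_smul K (g j) _), map_sum, Finset.smul_sum, ← hg]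
        refine Finset.sum_congr rfl fun l hl => ?_
        rw [map_smul, smul_smul, ← hh l hl, Function.comp_apply]
      exact (smul_eq_zero.mp h1).resolve_left hgj
    have h1 := (map_eq_zero_iff i hi).mp h0
    have h2 : ∑ l ∈ s, res (h l) • b l = 0 := by
      rw [← map_zero q, ← h1, map_sum]
      exact Finset.sum_congr rfl fun l _ => by rw [hqs, hn]
    have h3 := linearIndependent_iff'.mp b.linearIndependent s _ h2 j hj
    have h4 : h j = 1 := by
      ext
      simp only [h, dif_pos hj, OneMemClass.coe_one]
      exact div_self hgj
    rw [h4, map_one] at h3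
    exact one_ne_zero h3
  have hliK := (LinearIndependent.iff_fractionRing A K).mp hli
  have := hliK.finite
  exact Module.Finite.of_basis b

variable (K) in
/-- The inclusion of the restriction of `B` to `K` into `B`. -/
def comapHom (B : ValuationSubring L) : B.comap (algebraMap K L) →+* B :=
  ((algebraMap K L).comp (B.comap (algebraMap K L)).subtype).codRestrict B.toSubring fun a => a.2

instance (B : ValuationSubring L) : IsLocalHom (comapHom K B) := by
  refine ((local_hom_TFAE _).out 2 0).mp ?_
  rw [Ideal.map_le_iff_le_comap]
  intro a ha
  rw [Ideal.mem_comap, valuation_lt_one_iff, ← ValuationSubring.mem_nonunits_iff]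
  rw [valuation_lt_one_iff, ← ValuationSubring.mem_nonunits_iff] at ha
  exact mem_nonunits_comap.mp ha

/-- The extension of residue fields of `B` over its restriction to `K`. -/
noncomputable instance residueAlgebra (B : ValuationSubring L) :
    Algebra (ResidueField (B.comap (algebraMap K L))) (ResidueField B) :=
  (ResidueField.map (comapHom K B)).toAlgebra

theorem algebraMap_residue (B : ValuationSubring L) (a : B.comap (algebraMap K L)) :
    algebraMap (ResidueField (B.comap (algebraMap K L))) (ResidueField B) (residue _ a) =
      residue B (comapHom K B a) := rfl

variable (K) in
theorem finite_residueField [FiniteDimensional K L] (B : ValuationSubring L)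
    [Finite (ResidueField (B.comap (algebraMap K L)))] : Finite (ResidueField B) := by
  let A := B.comap (algebraMap K L)
  let : Module A B := Module.compHom B (comapHom K B)
  let i : B →ₗ[A] L :=
    { toFun := fun x => x
      map_add' := fun _ _ => rfl
      map_smul' := fun a x => by
        simp only [RingHom.id_apply]
        rw [Algebra.smul_def a (x : L)]
        rfl }
  have : Module.Finite (ResidueField A) (ResidueField B) :=
    finite_of_reduction (residue A) i Subtype.val_injective (residue B).toAddMonoidHom
      residue_surjective fun a x => by
        rw [Algebra.smul_def, algebraMap_residue]
        exact map_mul (residue B) _ _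
  exact Module.finite_of_finite (ResidueField A)

/-- The map from the integral closure of the restriction of `B` to `B`. -/
def ofIntegralClosure {A : ValuationSubring K} {B : ValuationSubring L}
    (h : B.comap (algebraMap K L) = A) : integralClosure A L →+* B :=
  (integralClosure A L).val.toRingHom.codRestrict B.toSubring fun s =>
    mem_of_isIntegral (fun a ha => by rw [← h] at ha; exact ha) s.2

/-- The center of `B` on the integral closure of its restriction. -/
def center {A : ValuationSubring K} {B : ValuationSubring L}
    (h : B.comap (algebraMap K L) = A) : Ideal (integralClosure A L) :=
  (maximalIdeal B).comap (ofIntegralClosure h)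

instance {A : ValuationSubring K} {B : ValuationSubring L}
    (h : B.comap (algebraMap K L) = A) : (center h).IsPrime := by
  unfold center; infer_instance

theorem mem_center {A : ValuationSubring K} {B : ValuationSubring L}
    (h : B.comap (algebraMap K L) = A) (s : integralClosure A L) :
    s ∈ center h ↔ (s : L) ∈ B.nonunits := by
  rw [center, Ideal.mem_comap, valuation_lt_one_iff, ← ValuationSubring.mem_nonunits_iff]
  rfl

theorem eq_of_center_eq [Algebra.IsAlgebraic K L] {A : ValuationSubring K}
    {B B' : ValuationSubring L} (h : B.comap (algebraMap K L) = A)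
    (h' : B'.comap (algebraMap K L) = A) (hc : center h = center h') : B = B' := by
  have key : ∀ s : L, IsIntegral A s → (s ∈ B.nonunits ↔ s ∈ B'.nonunits) := fun s hs => by
    have := congrArg (fun I => (⟨s, hs⟩ : integralClosure A L) ∈ I) hc
    simpa only [mem_center, eq_iff_iff] using this
  refine le_antisymm (le_of_center_le (K := K) (h.trans h'.symm) fun s hs => ?_)
    (le_of_center_le (K := K) (h'.trans h.symm) fun s hs => ?_)
  · rw [h] at hs; exact (key s hs).mpr
  · rw [h'] at hs; exact (key s hs).mp

theorem comap_center {A : ValuationSubring K} {B : ValuationSubring L}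
    (h : B.comap (algebraMap K L) = A) :
    (center h).comap (algebraMap A (integralClosure A L)) = maximalIdeal A := by
  ext a
  rw [Ideal.mem_comap, mem_center, valuation_lt_one_iff, ← ValuationSubring.mem_nonunits_iff]
  subst h
  exact mem_nonunits_comap.symm

/-- The quotient of S by the extended maximal ideal is finite-dimensional over the residue field,
hence Artinian, and its finite spectrum is this zero locus. -/
theorem finite_zeroLocus_map_maximalIdeal (A : ValuationSubring K) {V : Type*} [AddCommGroup V]
    [Module K V] [Module.Finite K V] [Module A V] [IsScalarTower A K V] {S : Type*} [CommRing S]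
    [Algebra A S] (i : S →ₗ[A] V) (hi : Function.Injective i) :
    (PrimeSpectrum.zeroLocus ((maximalIdeal A).map (algebraMap A S) : Set S)).Finite := by
  set I : Ideal S := (maximalIdeal A).map (algebraMap A S)
  let f : ResidueField A →+* S ⧸ I :=
    Ideal.Quotient.lift (maximalIdeal A) ((Ideal.Quotient.mk I).comp (algebraMap A S)) fun a ha =>
      Ideal.Quotient.eq_zero_iff_mem.mpr (Ideal.mem_map_of_mem _ ha)
  let := f.toAlgebra
  have : Module.Finite (ResidueField A) (S ⧸ I) :=
    finite_of_reduction (residue A) i hi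
      (Ideal.Quotient.mk I).toAddMonoidHom Ideal.Quotient.mk_surjective fun a x => by
        rw [Algebra.smul_def, Algebra.smul_def]
        exact map_mul (Ideal.Quotient.mk I) _ _
  have := IsArtinianRing.of_finite (ResidueField A) (S ⧸ I)
  have h := range_comap_of_surjective _ (Ideal.Quotient.mk I)
    Ideal.Quotient.mk_surjective
  rw [Ideal.mk_ker] at h
  rw [← h]
  exact Set.finite_range _

/-- B is determined by its center on the integral closure of A, a prime over the maximal ideal of A.
-/
theorem finite_comap_eq [FiniteDimensional K L] (A : ValuationSubring K) :
    {B : ValuationSubring L | B.comap (algebraMap K L) = A}.Finite := by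
  have hfin := finite_zeroLocus_map_maximalIdeal A (integralClosure A L).val.toLinearMap
    Subtype.val_injective
  have := hfin.to_subtype
  let c : {B : ValuationSubring L | B.comap (algebraMap K L) = A} →
      PrimeSpectrum.zeroLocus ((maximalIdeal A).map (algebraMap A (integralClosure A L)) :
        Set (integralClosure A L)) := fun B =>
    ⟨⟨center B.2, inferInstance⟩, Ideal.map_le_iff_le_comap.mpr (comap_center B.2).ge⟩
  exact Set.finite_coe_iff.mp (Finite.of_injective c fun B B' h =>
    Subtype.ext (eq_of_center_eq B.2 B'.2 congr(($h).1.1)))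

end ValuationSubring

/-! ### Valuation subrings of global fields -/

namespace ValuationSubring

open IsLocalRing Polynomial

/-- Every element lies in all but finitely many valuation subrings, and the residue fields are
finite. -/
structure IsArithmetic (K : Type*) [Field K] : Prop where
  finite_notMem : ∀ x : K, {A : ValuationSubring K | A ≠ ⊤ ∧ x ∉ A}.Finite
  finite_residueField : ∀ A : ValuationSubring K, A ≠ ⊤ → Finite (ResidueField A)

/-- Since B is integrally closed, x can be missing from B only if a coefficient of its minimal
polynomial is missing from the restriction of B. This leaves finitely many restrictions, and each
has finitely many extensions. -/
theorem IsArithmetic.of_finiteDimensional {K : Type*} (L : Type*) [Field K] [Field L] [Algebra K L]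
    [FiniteDimensional K L] (hK : IsArithmetic K) : IsArithmetic L where
  finite_notMem x := by
    have hx := Algebra.IsIntegral.isIntegral (R := K) x
    refine Set.Finite.subset ((Set.Finite.biUnion (minpoly K x).support.finite_toSet fun i _ =>
      hK.finite_notMem ((minpoly K x).coeff i)).biUnion fun A _ => finite_comap_eq (L := L) A) ?_
    rintro B ⟨hB, hxB⟩
    simp only [Set.mem_iUnion, exists_prop]
    refine ⟨B.comap (algebraMap K L), ?_, rfl⟩
    by_contra! hcon
    refine hxB (mem_of_isIntegral (A := B.comap (algebraMap K L)) (B := B) (fun a ha => ha) ?_)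
    have hcoeff : ∀ i, (minpoly K x).coeff i ∈ (B.comap (algebraMap K L)).toSubring := by
      intro i
      by_cases hi : i ∈ (minpoly K x).support
      · by_contra hn
        exact hcon i hi ⟨ne_top_of_comap hB, hn⟩
      · rw [notMem_support_iff.mp hi]; exact ZeroMemClass.zero_mem _
    have hsub : ((minpoly K x).coeffs : Set K) ⊆ (B.comap (algebraMap K L)).toSubring := by
      intro y hy
      obtain ⟨i, -, rfl⟩ := Polynomial.mem_coeffs_iff.mp hy
      exact hcoeff i
    refine ⟨(minpoly K x).toSubring _ hsub, (monic_toSubring _ _ hsub).mpr (minpoly.monic hx), ?_⟩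
    have h1 : ((minpoly K x).toSubring _ hsub).map
        (B.comap (algebraMap K L)).toSubring.subtype = minpoly K x := map_toSubring _ _ hsub
    have h2 := minpoly.aeval K x
    rw [← h1, aeval_def, eval₂_map] at h2
    exact h2
  finite_residueField B hB := by
    have := hK.finite_residueField _ (ne_top_of_comap (K := K) hB)
    exact ValuationSubring.finite_residueField K B

theorem isFractionRing_toAlgebra {R K : Type*} [CommRing R] [Field K] (j : R →+* K)
    (hj : Function.Injective j) (hj' : ∀ z, ∃ x y, z = j x / j y) :
    letI := j.toAlgebra
    IsFractionRing R K := by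
  let := j.toAlgebra
  have : FaithfulSMul R K := (faithfulSMul_iff_algebraMap_injective _ _).mpr hj
  exact IsFractionRing.of_field _ _ hj'

/-! ### Valuation subrings containing a principal ideal domain -/

section FractionRing

variable {R K : Type*} [CommRing R] [Field K] [Algebra R K]

theorem inv_mem_of_notMem_nonunits {K : Type*} [Field K] {A : ValuationSubring K} {b : K}
    (hb : b ∉ A.nonunits) : b⁻¹ ∈ A := by
  by_contra hn
  refine hb ?_
  rw [← inv_inv b, ValuationSubring.inv_mem_nonunits_iff]
  exact Or.inr hn

/-- The restriction of the maximal ideal of `A`. -/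
def under {A : ValuationSubring K} (hA : ∀ r : R, algebraMap R K r ∈ A) : Ideal R :=
  (maximalIdeal A).comap ((algebraMap R K).codRestrict A.toSubring hA)

theorem mem_under {A : ValuationSubring K} (hA : ∀ r : R, algebraMap R K r ∈ A) (r : R) :
    r ∈ under hA ↔ algebraMap R K r ∈ A.nonunits := by
  rw [under, Ideal.mem_comap, valuation_lt_one_iff, ← ValuationSubring.mem_nonunits_iff]
  rfl

instance {A : ValuationSubring K} (hA : ∀ r : R, algebraMap R K r ∈ A) :
    (under hA).IsPrime := by
  unfold under; infer_instance

theorem mem_under_of_div_notMem {A : ValuationSubring K} (hA : ∀ r : R, algebraMap R K r ∈ A)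
    {a b : R} (h : algebraMap R K a / algebraMap R K b ∉ A) : b ∈ under hA := by
  rw [mem_under]
  by_contra hb
  refine h ?_
  rw [div_eq_mul_inv]
  exact A.mul_mem _ _ (hA a) (inv_mem_of_notMem_nonunits hb)

variable [IsDomain R] [IsPrincipalIdealRing R] [IsFractionRing R K]

/-- For x = a/b in lowest terms, ua + wb = 1. If b were a nonunit of A, then so would be a = xb, and
hence 1. -/
theorem exists_mul_eq_of_mem {A : ValuationSubring K} (hA : ∀ r : R, algebraMap R K r ∈ A) {x : K}
    (hx : x ∈ A) : ∃ a b : R, algebraMap R K b ∉ A.nonunits ∧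
      x * algebraMap R K b = algebraMap R K a := by
  obtain ⟨a, b, hab, rfl⟩ := IsFractionRing.exists_reduced_fraction R x
  obtain ⟨u, w, huw⟩ := hab.isCoprime
  refine ⟨a, b, fun hb => ?_, IsLocalization.mk'_spec K a b⟩
  have hmul : ∀ y ∈ A, ∀ z ∈ A.nonunits, y * z ∈ A.nonunits := fun y hy z hz => by
    rw [ValuationSubring.mem_nonunits_iff] at hz ⊢
    rw [mul_comm, map_mul]
    exact mul_lt_one_of_lt_of_le hz ((A.valuation_le_one_iff y).mpr hy)
  have h1 : (1 : K) ∈ A.nonunits := by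
    rw [← map_one (algebraMap R K), ← huw, map_add, map_mul, map_mul]
    refine AddMemClass.add_mem (hmul _ (hA u) _ ?_) (hmul _ (hA w) _ hb)
    rw [← IsLocalization.mk'_spec K a b]
    exact hmul _ hx _ hb
  simp [ValuationSubring.mem_nonunits_iff] at h1

/-- A consists of the fractions with denominator outside `under hA`, so a smaller prime gives a
larger ring. -/
theorem under_le_of_le {A A' : ValuationSubring K} (hA : ∀ r : R, algebraMap R K r ∈ A)
    (hA' : ∀ r : R, algebraMap R K r ∈ A') (h : under hA' ≤ under hA) : A ≤ A' := by
  intro x hx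
  obtain ⟨a, b, hb, hab⟩ := exists_mul_eq_of_mem hA hx
  have hb' : algebraMap R K b ∉ A'.nonunits := fun hn =>
    hb ((mem_under hA b).mp (h ((mem_under hA' b).mpr hn)))
  have hb0 : algebraMap R K b ≠ 0 := by
    intro h0; rw [h0] at hb; exact hb (ZeroMemClass.zero_mem _)
  rw [eq_div_of_mul_eq hb0 hab, div_eq_mul_inv]
  exact A'.mul_mem _ _ (hA' a) (inv_mem_of_notMem_nonunits hb')

variable [Ring.HasFiniteQuotients R]

variable (R) in
-- If a/b is not in A, then b lies in the prime below A. A nonzero b lies in finitely many ideals,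
-- and the prime determines A.
theorem finite_le_notMem (x : K) :
    {A : ValuationSubring K | (∀ r : R, algebraMap R K r ∈ A) ∧ x ∉ A}.Finite := by
  obtain ⟨a, b, hb, rfl⟩ := IsFractionRing.div_surjective (A := R) x
  have hfin := Ring.HasFiniteQuotients.finite_setOfPred_mem b (nonZeroDivisors.ne_zero hb)
  have := hfin.to_subtype
  let c : {A : ValuationSubring K | (∀ r : R, algebraMap R K r ∈ A) ∧
      algebraMap R K a / algebraMap R K b ∉ A} → {I : Ideal R | b ∈ I} := fun A =>
    ⟨under A.2.1, mem_under_of_div_notMem A.2.1 A.2.2⟩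
  refine Set.finite_coe_iff.mp (Finite.of_injective c fun A A' h => Subtype.ext ?_)
  have h' : under A.2.1 = under A'.2.1 := congrArg Subtype.val h
  exact le_antisymm (under_le_of_le _ _ h'.ge) (under_le_of_le _ _ h'.le)

/-- The prime below A is nonzero, hence maximal with finite quotient. Denominators are invertible
modulo it, so this quotient surjects onto the residue field of A. -/
theorem finite_residueField_of_le {A : ValuationSubring K} (hA : ∀ r : R, algebraMap R K r ∈ A)
    (hA' : A ≠ ⊤) : Finite (ResidueField A) := by
  obtain ⟨x, hx⟩ : ∃ x, x ∉ A := by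
    by_contra! h
    exact hA' (top_unique fun y _ => h y)
  have hne : under hA ≠ ⊥ := by
    obtain ⟨a, b, hb, rfl⟩ := IsFractionRing.div_surjective (A := R) x
    intro h
    have := mem_under_of_div_notMem hA hx
    rw [h, Ideal.mem_bot] at this
    exact nonZeroDivisors.ne_zero hb this
  have := Ring.HasFiniteQuotients.finiteQuotient hne
  have hmax := Ring.HasFiniteQuotients.maximalOfPrime hne
  let j : R →+* A := (algebraMap R K).codRestrict A.toSubring hA
  have hj : ∀ r, r ∈ under hA ↔ residue A (j r) = 0 := fun r => by
    rw [residue_eq_zero_iff]; rfl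
  let f : R ⧸ under hA →+* ResidueField A :=
    Ideal.Quotient.lift _ ((residue A).comp j) fun r hr => (hj r).mp hr
  refine Finite.of_surjective f fun y => ?_
  obtain ⟨⟨y, hy⟩, rfl⟩ := residue_surjective y
  obtain ⟨a, b, hb, hab⟩ := exists_mul_eq_of_mem hA hy
  rw [← mem_under hA] at hb
  obtain ⟨c, i, hi, hci⟩ := hmax.exists_inv hb
  refine ⟨Ideal.Quotient.mk _ (c * a), ?_⟩
  have h1 : residue A (j c) * residue A (j b) = 1 := by
    have := congrArg (fun r => residue A (j r)) hci
    simpa only [map_add, map_mul, (hj i).mp hi, add_zero, map_one] using this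
  have h2 : (⟨y, hy⟩ : A) * j b = j a := Subtype.ext hab
  change residue A (j (c * a)) = _
  rw [map_mul, map_mul, ← h2, map_mul, mul_left_comm, h1, mul_one]

end FractionRing

theorem isArithmetic_rat : IsArithmetic ℚ where
  finite_notMem x := (finite_le_notMem ℤ x).subset fun A hA =>
    ⟨fun r => by rw [eq_intCast]; exact intCast_mem A r, hA.2⟩
  finite_residueField A hA :=
    finite_residueField_of_le (R := ℤ) (fun r => by rw [eq_intCast]; exact intCast_mem A r) hA

/-! ### Rational function fields over finite fields -/

section RatFunc

variable (k : Type*) [Field k]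

theorem hasFiniteQuotients_polynomial [Finite k] : Ring.HasFiniteQuotients k[X] where
  finiteQuotient {I} hI := by
    obtain ⟨f, rfl⟩ := Submodule.IsPrincipal.principal I
    have hf : f ≠ 0 := by rintro rfl; simp at hI
    have : Module.Finite k (k[X] ⧸ Ideal.span {f}) := (AdjoinRoot.powerBasis hf).finite
    exact Module.finite_of_finite k

/-- The embedding of `k[X]` in `k(X)` that sends `X` to `X⁻¹`. -/
noncomputable def aevalInvX : k[X] →ₐ[k] RatFunc k := aeval (RatFunc.X⁻¹ : RatFunc k)

theorem aevalInvX_reverse_mul (f : k[X]) :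
    aevalInvX k f.reverse * RatFunc.X ^ f.natDegree = algebraMap k[X] (RatFunc k) f := by
  have := invertibleOfNonzero (RatFunc.X_ne_zero (K := k))
  have h := eval₂_reverse_mul_pow (algebraMap k (RatFunc k)) RatFunc.X f
  rw [invOf_eq_inv] at h
  rw [aevalInvX, aeval_def, h, ← aeval_def, RatFunc.aeval_X_left_eq_algebraMap]

theorem aevalInvX_injective : Function.Injective (aevalInvX k) := by
  refine transcendental_iff_injective.mp fun h => ?_
  exact RatFunc.transcendental_X (IsAlgebraic.inv_iff.mp h)

theorem exists_eq_aevalInvX_div (z : RatFunc k) :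
    ∃ f g : k[X], z = aevalInvX k f / aevalInvX k g := by
  obtain ⟨f, g, hg, rfl⟩ := IsFractionRing.div_surjective (A := k[X]) z
  -- Reversal gives f(X) = f.reverse(X⁻¹) X^(deg f), and likewise for g; the powers of X are moved
  -- across the fraction so that only X⁻¹ occurs.
  refine ⟨f.reverse * X ^ g.natDegree, g.reverse * X ^ f.natDegree, ?_⟩
  rw [← aevalInvX_reverse_mul, ← aevalInvX_reverse_mul, map_mul, map_mul, map_pow, map_pow,
    show aevalInvX k X = RatFunc.X⁻¹ from aeval_X _]
  have hX := RatFunc.X_ne_zero (K := k)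
  rcases eq_or_ne (aevalInvX k g.reverse) 0 with h0 | h0
  · simp [h0]
  · have hX' : ∀ n : ℕ, (RatFunc.X : RatFunc k) ^ n ≠ 0 := fun n => pow_ne_zero n hX
    have hX'' : ∀ n : ℕ, (RatFunc.X : RatFunc k)⁻¹ ^ n = (RatFunc.X ^ n)⁻¹ := fun n => inv_pow _ n
    rw [hX'', hX'']
    have h1 := hX' f.natDegree
    have h2 := hX' g.natDegree
    generalize (RatFunc.X : RatFunc k) ^ f.natDegree = y at *
    generalize (RatFunc.X : RatFunc k) ^ g.natDegree = z at *
    field_simp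

end RatFunc

/-- Elements of a finite field are roots of a monic X^q - X, hence integral over ℤ, so every
valuation subring contains the constants. -/
theorem aeval_mem {k K : Type*} [Field k] [Finite k] [Field K] [Algebra k K]
    (A : ValuationSubring K) {x : K} (hx : x ∈ A) (f : k[X]) : aeval x f ∈ A := by
  rw [aeval_eq_sum_range]
  refine sum_mem fun i _ => ?_
  rw [Algebra.smul_def]
  refine A.mul_mem _ _ ?_ (pow_mem hx i)
  have hint : IsIntegral ℤ (algebraMap k K (f.coeff i)) := by
    refine IsIntegral.map (algebraMap k K).toIntAlgHom ?_
    have := Fintype.ofFinite k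
    refine ⟨X ^ Fintype.card k - X, monic_X_pow_sub ?_, ?_⟩
    · rw [degree_X, Nat.one_lt_cast]; exact Fintype.one_lt_card
    · simp [FiniteField.pow_card]
  obtain ⟨z, hz⟩ := IsIntegrallyClosed.isIntegral_iff.mp (hint.tower_top (A := A))
  rw [← hz]
  exact z.2

/-- Each valuation subring contains X or X⁻¹, hence the image of k[X] under one of two embeddings
with fraction field k(X); both cases fall under principal ideal domains with finite quotients. -/
theorem isArithmetic_ratFunc (k : Type*) [Field k] [Finite k] : IsArithmetic (RatFunc k) := by
  have := hasFiniteQuotients_polynomial k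
  have h1 : ∀ A : ValuationSubring (RatFunc k), RatFunc.X ∈ A →
      ∀ r : k[X], algebraMap k[X] (RatFunc k) r ∈ A := fun A hA r => by
    rw [← RatFunc.aeval_X_left_eq_algebraMap]; exact aeval_mem A hA r
  have h2 : ∀ A : ValuationSubring (RatFunc k), RatFunc.X⁻¹ ∈ A →
      ∀ r : k[X], aevalInvX k r ∈ A := fun A hA r => aeval_mem A hA r
  have h3 := isFractionRing_toAlgebra (aevalInvX k).toRingHom (aevalInvX_injective k)
    (exists_eq_aevalInvX_div k)
  constructor
  · intro x
    refine ((finite_le_notMem k[X] x).union (@finite_le_notMem k[X] (RatFunc k) _ _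
      (aevalInvX k).toRingHom.toAlgebra _ _ h3 _ x)).subset ?_
    rintro A ⟨-, hx⟩
    rcases A.mem_or_inv_mem RatFunc.X with h | h
    exacts [Or.inl ⟨h1 A h, hx⟩, Or.inr ⟨h2 A h, hx⟩]
  · intro A hA
    rcases A.mem_or_inv_mem RatFunc.X with h | h
    · exact finite_residueField_of_le (h1 A h) hA
    · exact @finite_residueField_of_le k[X] (RatFunc k) _ _
        (aevalInvX k).toRingHom.toAlgebra _ _ h3 _ A (h2 A h) hA

end ValuationSubring

namespace Selmerable

theorem IsGlobalField.isArithmetic {F : Type u} [Field F] (hF : IsGlobalField F) :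
    ValuationSubring.IsArithmetic F := by
  rcases hF with hF | ⟨p, hp, _, hF⟩
  · exact ValuationSubring.isArithmetic_rat.of_finiteDimensional F
  · exact (ValuationSubring.isArithmetic_ratFunc (ZMod p)).of_finiteDimensional F

theorem IsGlobalField.finite_infinitePlace {F : Type u} [Field F] (hF : IsGlobalField F) :
    Finite (NumberField.InfinitePlace F) := by
  rcases hF with hF | ⟨p, hp, _, hF⟩
  · infer_instance
  · have : CharP F p := charP_of_injective_algebraMap (algebraMap (RatFunc (ZMod p)) F).injective p
    have : IsEmpty (NumberField.InfinitePlace F) := ⟨fun w => by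
      have := charP_of_injective_ringHom w.embedding.injective p
      exact hp.out.ne_zero (CharP.eq ℂ this (CharP.ofCharZero ℂ))⟩
    infer_instance

end Selmerable

/-! ### Decomposition groups over finite residue fields -/

namespace ValuationSubring

open IsLocalRing Polynomial
open scoped Pointwise

variable {K L : Type*} [Field K] [Field L] [Algebra K L]

theorem isIntegral_residue (B : ValuationSubring L) (s : B)
    (hs : IsIntegral (B.comap (algebraMap K L)) (s : L)) :
    IsIntegral (ResidueField (B.comap (algebraMap K L))) (residue B s) := by
  obtain ⟨p, hp, hps⟩ := hs
  refine ⟨p.map (residue _), hp.map _, ?_⟩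
  have h0 : eval₂ (comapHom K B) s p = 0 := by
    apply Subtype.val_injective
    exact (hom_eval₂ p (comapHom K B) B.subtype s).trans hps
  rw [eval₂_map, show (algebraMap (ResidueField (B.comap (algebraMap K L)))
    (ResidueField B)).comp (residue _) = (residue B).comp (comapHom K B) from rfl,
    ← hom_eval₂, h0, map_zero]

variable (K) in
/-- Every residue class is a fraction of residue classes of integral elements. -/
theorem exists_residue_mul_eq [Algebra.IsAlgebraic K L] (B : ValuationSubring L)
    (y : ResidueField B) : ∃ b c : integralClosure (B.comap (algebraMap K L)) L,
      residue B (ofIntegralClosure rfl b) ≠ 0 ∧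
      residue B (ofIntegralClosure rfl b) * y = residue B (ofIntegralClosure rfl c) := by
  obtain ⟨⟨x, hx⟩, rfl⟩ := residue_surjective y
  obtain ⟨b, c, hb, hc, hbn, hbc⟩ := exists_isIntegral_mul_eq (K := K) hx
  refine ⟨⟨b, hb⟩, ⟨c, hc⟩, ?_, ?_⟩
  · rw [Ne, residue_eq_zero_iff, valuation_lt_one_iff, ← ValuationSubring.mem_nonunits_iff]
    exact hbn
  · rw [← map_mul]
    congr 1
    exact Subtype.ext hbc

/-- Every residue class is a fraction of residues of integral elements, and those are integral over
the lower residue field. -/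
theorem isAlgebraic_residueField [Algebra.IsAlgebraic K L] (B : ValuationSubring L) :
    Algebra.IsAlgebraic (ResidueField (B.comap (algebraMap K L))) (ResidueField B) where
  isAlgebraic y := by
    obtain ⟨b, c, hb, hbc⟩ := exists_residue_mul_eq K B y
    rw [eq_div_of_mul_eq hb ((mul_comm _ _).trans hbc)]
    exact (isIntegral_residue B (ofIntegralClosure rfl c) c.2).isAlgebraic.mul
      (isIntegral_residue B (ofIntegralClosure rfl b) b.2).isAlgebraic.inv

/-- Fieldness is a hypothesis here, not a structure, so that the lemma applies to quotients by
maximal ideals with their given ring structure. -/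
theorem exists_algEquiv_eq_pow {k l : Type*} [CommRing k] [CommRing l] [Algebra k l] [Finite k]
    [Algebra.IsIntegral k l] (hk : IsField k) (hl : IsField l) :
    ∃ f : l ≃ₐ[k] l, ∀ x, f x = x ^ Nat.card k := by
  let := hk.toField
  let := hl.toField
  have := Fintype.ofFinite k
  have : Algebra.IsAlgebraic k l := ⟨fun x => (Algebra.IsIntegral.isIntegral x).isAlgebraic⟩
  refine ⟨FiniteField.frobeniusAlgEquivOfAlgebraic k l, fun x => ?_⟩
  rw [FiniteField.coe_frobeniusAlgEquivOfAlgebraic, Fintype.card_eq_nat_card]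

section Galois

variable (B : ValuationSubring L)

/-- A fixed element lies in K by Galois theory and is integral over A, which is integrally closed.
-/
theorem isInvariant_integralClosure [IsGalois K L] (A : ValuationSubring K) :
    Algebra.IsInvariant A (integralClosure A L) Gal(L/K) where
  isInvariant s hs := by
    obtain ⟨x, hx⟩ := (InfiniteGalois.mem_bot_iff_fixed (s : L)).mpr fun σ =>
      congrArg Subtype.val (hs σ)
    have hx' : algebraMap K L x = s := hx
    have hint : IsIntegral A x := by
      have := s.2
      rw [← hx'] at this
      exact (isIntegral_algebraMap_iff (algebraMap K L).injective).mp this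
    obtain ⟨a, rfl⟩ := IsIntegrallyClosed.isIntegral_iff.mp hint
    exact ⟨a, Subtype.ext hx'⟩

theorem smul_comap (σ : Gal(L/K)) :
    (σ • B).comap (algebraMap K L) = B.comap (algebraMap K L) := by
  ext x
  rw [mem_comap, mem_comap, mem_pointwise_smul_iff_inv_smul_mem]
  simp

theorem mem_nonunits_smul (σ : Gal(L/K)) (x : L) :
    x ∈ (σ • B).nonunits ↔ σ⁻¹ • x ∈ B.nonunits := by
  rw [mem_nonunits_iff_or, mem_nonunits_iff_or, mem_pointwise_smul_iff_inv_smul_mem, smul_inv'',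
    smul_eq_zero_iff_eq]

theorem smul_eq_of_smul_center_eq [Algebra.IsAlgebraic K L] (σ : Gal(L/K))
    (h : σ • center (rfl : B.comap (algebraMap K L) = _) = center rfl) : σ • B = B := by
  refine eq_of_center_eq (smul_comap B σ) rfl ?_
  rw [← h]
  ext s
  rw [mem_center, Ideal.mem_pointwise_smul_iff_inv_smul_mem, mem_center, mem_nonunits_smul]
  rfl

variable (K) in
/-- A Frobenius element exists in the decomposition group. -/
theorem exists_frobenius [IsGalois K L] [Finite (ResidueField (B.comap (algebraMap K L)))] :
    ∃ φ : B.decompositionSubgroup K, ∀ y : ResidueField B,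
      φ • y = y ^ Nat.card (ResidueField (B.comap (algebraMap K L))) := by
  set A := B.comap (algebraMap K L) with hA
  let S := integralClosure A L
  let P : Ideal A := maximalIdeal A
  let Q : Ideal S := center (B := B) rfl
  have hPQ : Q.LiesOver P := ⟨(comap_center rfl).symm⟩
  have hmax : Q.IsMaximal :=
    Ideal.isMaximal_of_isIntegral_of_isMaximal_comap Q (by
      rw [show Ideal.comap (algebraMap A S) Q = P from comap_center rfl]; infer_instance)
  let : TopologicalSpace S := ⊥
  have : DiscreteTopology S := ⟨rfl⟩
  have : ContinuousSMul Gal(L/K) S := continuousSMul_iff_stabilizer_isOpen.mpr fun s => by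
    convert stabilizer_isOpen_of_isIntegral (K := K) (s : L) using 1
    ext σ
    exact Subtype.ext_iff
  have := isInvariant_integralClosure (L := L) A
  -- The stabilizer of Q in the profinite Galois group surjects onto the automorphisms of S ⧸ Q over
  -- A ⧸ P. A lift of Frobenius stabilizes the center Q, hence B itself.
  have hsurj := Ideal.Quotient.stabilizerHom_surjective_of_profinite (G := Gal(L/K)) P Q
  let q := Nat.card (ResidueField A)
  have hfin : Finite (A ⧸ P) := ‹Finite (ResidueField A)›
  obtain ⟨f, hf⟩ : ∃ f : (S ⧸ Q) ≃ₐ[A ⧸ P] (S ⧸ Q), ∀ x, f x = x ^ q := by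
    exact exists_algEquiv_eq_pow (k := A ⧸ P) (l := S ⧸ Q)
      ((Ideal.Quotient.maximal_ideal_iff_isField_quotient P).mp inferInstance)
      ((Ideal.Quotient.maximal_ideal_iff_isField_quotient Q).mp hmax)
  obtain ⟨⟨σ, hσ⟩, hσf⟩ := hsurj f
  have hσB : σ • B = B := smul_eq_of_smul_center_eq B σ hσ
  have hres : ∀ s : S, residue B (ofIntegralClosure rfl (σ • s)) =
      residue B (ofIntegralClosure rfl s) ^ q := fun s => by
    have h1 : Ideal.Quotient.mk Q (σ • s) = Ideal.Quotient.mk Q (s ^ q) := by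
      rw [map_pow, ← hf, ← hσf]; rfl
    rw [← map_pow, ← map_pow, ← sub_eq_zero, ← map_sub, ← map_sub, residue_eq_zero_iff]
    exact Ideal.Quotient.eq.mp h1
  refine ⟨⟨σ, hσB⟩, fun y => ?_⟩
  -- The power formula is known on residues of integral elements; it extends to their fractions
  -- because both sides are multiplicative.
  obtain ⟨b, c, hb, hbc⟩ := exists_residue_mul_eq K B y
  have hsm : ∀ s : S, (⟨σ, hσB⟩ : B.decompositionSubgroup K) • residue B (ofIntegralClosure rfl s) =
      residue B (ofIntegralClosure rfl s) ^ q := fun s => by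
    rw [← hres]; rfl
  have h := congrArg (fun z => (⟨σ, hσB⟩ : B.decompositionSubgroup K) • z) hbc
  simp only [smul_mul', hsm] at h
  rw [← hbc, mul_pow] at h
  exact mul_left_cancel₀ (pow_ne_zero _ hb) h

end Galois

end ValuationSubring

/-- The quotient of `Γ` by `I` is topologically generated by the image of one element, and has
quotients of order divisible by any given number. -/
def HasFreeFrobenius {Γ : Type*} [Group Γ] [TopologicalSpace Γ] (I : Subgroup Γ) : Prop :=
  ∃ φ : Γ, ∀ n : ℕ, 0 < n → ∀ U : Subgroup Γ, IsOpen (U : Set Γ) → I ≤ U →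
    ∃ N : Subgroup Γ, N.Normal ∧ IsOpen (N : Set Γ) ∧ I ≤ N ∧ N ≤ U ∧
      (∀ γ, ∃ i : ℕ, (φ ^ i)⁻¹ * γ ∈ N) ∧ ∀ i : ℕ, φ ^ i ∈ N → n ∣ i

/-- On a finite subextension, an automorphism over a finite field is a power of Frobenius. -/
theorem exists_algEquiv_apply_eq_pow {k l : Type*} [Field k] [Finite k] [Field l] [Algebra k l]
    (E : IntermediateField k l) [FiniteDimensional k E] (σ : l ≃ₐ[k] l) :
    ∃ i : ℕ, ∀ y ∈ E, σ y = y ^ Nat.card k ^ i := by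
  have : Finite E := Module.finite_of_finite k
  have := Fintype.ofFinite k
  obtain ⟨i, hi⟩ := (FiniteField.bijective_frobeniusAlgEquivOfAlgebraic_pow k E).2
    (σ.restrictNormal E)
  refine ⟨i, fun y hy => ?_⟩
  have h := congrArg (fun τ : E ≃ₐ[k] E => ((τ ⟨y, hy⟩ : E) : l)) hi
  have h2 : ((σ.restrictNormal E ⟨y, hy⟩ : E) : l) = σ y :=
    AlgEquiv.restrictNormal_commutes σ E ⟨y, hy⟩
  simp only [h2] at h
  rw [← h, AlgEquiv.coe_pow, FiniteField.coe_frobeniusAlgEquivOfAlgebraic_iterate,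
    Fintype.card_eq_nat_card]
  rfl

/-- The gcd of q^n - 1 and q^i - 1 is q^d - 1 with d = gcd(n, i), so the hypothesis forces d = n. -/
theorem Nat.dvd_of_pow_sub_one_dvd {q n i : ℕ} (hq : 2 ≤ q) (h : q ^ n - 1 ∣ q ^ i - 1) :
    n ∣ i := by
  have h1 := Nat.pow_sub_one_gcd_pow_sub_one q n i
  rw [Nat.gcd_eq_left h] at h1
  have h2 : q ^ n = q ^ n.gcd i := by
    have := Nat.one_le_pow n q (by omega)
    have := Nat.one_le_pow (n.gcd i) q (by omega)
    omega
  rw [Nat.pow_right_injective hq h2]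
  exact Nat.gcd_dvd_right n i

/-! ### The quotient of a decomposition group by inertia -/

namespace ValuationSubring

open IsLocalRing Polynomial
open scoped Pointwise

variable {K L : Type*} [Field K] [Field L] [Algebra K L] (B : ValuationSubring L)

/-- The decomposition group fixes K, so it acts linearly over the lower residue field; this makes
its elements algebra automorphisms. -/
instance : SMulCommClass (B.decompositionSubgroup K)
    (ResidueField (B.comap (algebraMap K L))) (ResidueField B) where
  smul_comm γ a y := by
    obtain ⟨a, rfl⟩ := residue_surjective a
    rw [Algebra.smul_def, Algebra.smul_def, smul_mul', algebraMap_residue,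
      ← ResidueField.residue_smul]
    congr 3
    exact Subtype.ext (AlgEquiv.commutes (γ : Gal(L/K)) (a : K))

variable (K) in
theorem mem_inertiaSubgroup (γ : B.decompositionSubgroup K) :
    γ ∈ B.inertiaSubgroup K ↔ ∀ y : ResidueField B, γ • y = y := by
  rw [inertiaSubgroup, MonoidHom.mem_ker, RingEquiv.ext_iff]
  rfl

theorem isOpen_setOf_apply_mem [Algebra.IsIntegral K L] (x : L) (T : Set L) :
    IsOpen {σ : Gal(L/K) | σ x ∈ T} := by
  let : TopologicalSpace L := ⊥
  have : DiscreteTopology L := ⟨rfl⟩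
  have : ContinuousSMul Gal(L/K) L :=
    continuousSMul_iff_stabilizer_isOpen.mpr stabilizer_isOpen_of_isIntegral
  exact (isOpen_discrete T).preimage
    (continuous_id.smul (continuous_const (y := x)) : Continuous fun σ : Gal(L/K) => σ • x)

/-- Stabilizing B means satisfying, for every x, the clopen condition σx ∈ B ↔ x ∈ B. Closedness
gives the compactness used in `hasFreeFrobenius`. -/
theorem isClosed_decompositionSubgroup [Algebra.IsIntegral K L] :
    IsClosed (B.decompositionSubgroup K : Set Gal(L/K)) := by
  have : (B.decompositionSubgroup K : Set Gal(L/K)) =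
      ⋂ x : L, {σ : Gal(L/K) | σ x ∈ {y : L | y ∈ B ↔ x ∈ B}} := by
    ext σ
    simp only [SetLike.mem_coe, MulAction.mem_stabilizer_iff, Set.mem_iInter, Set.mem_ofPred_eq]
    constructor
    · intro h x
      conv_lhs => rw [← h]
      exact smul_mem_pointwise_smul_iff (g := σ)
    · intro h
      ext y
      rw [mem_pointwise_smul_iff_inv_smul_mem, ← h (σ⁻¹ • y)]
      change σ • σ⁻¹ • y ∈ B ↔ _
      rw [smul_inv_smul]
  rw [this]
  refine isClosed_iInter fun x => ⟨?_⟩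
  exact isOpen_setOf_apply_mem x {y : L | y ∈ B ↔ x ∈ B}ᶜ

instance [IsGalois K L] : CompactSpace (B.decompositionSubgroup K) :=
  isCompact_iff_compactSpace.mp (isClosed_decompositionSubgroup B).isCompact

theorem isOpen_stabilizer_residueField [Algebra.IsIntegral K L] (y : ResidueField B) :
    IsOpen (MulAction.stabilizer (B.decompositionSubgroup K) y :
      Set (B.decompositionSubgroup K)) := by
  obtain ⟨x, rfl⟩ := residue_surjective y
  refine Subgroup.isOpen_mono (H₁ := (MulAction.stabilizer Gal(L/K) (x : L)).subgroupOf
    (B.decompositionSubgroup K)) ?_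
    ((stabilizer_isOpen_of_isIntegral (x : L)).preimage continuous_subtype_val)
  intro γ hγ
  rw [MulAction.mem_stabilizer_iff, ← ResidueField.residue_smul]
  congr 1
  exact Subtype.ext hγ

/-- The residue field of a separably closed field contains all roots of unity of order prime to
the residue characteristic. -/
theorem exists_orderOf_eq [IsSepClosed L] {m : ℕ} (hm : 0 < m) (hmB : (m : ResidueField B) ≠ 0) :
    ∃ ζ : ResidueField B, orderOf ζ = m := by
  have hmL : (m : L) ≠ 0 := fun h => hmB (by
    have : (m : B) = 0 := Subtype.val_injective (by simpa using h)
    rw [← map_natCast (residue B), this, map_zero])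
  have : NeZero (m : L) := ⟨hmL⟩
  obtain ⟨ζ, hζ⟩ := HasEnoughRootsOfUnity.exists_primitiveRoot L m
  have hζB : ζ ∈ B := by
    refine mem_of_isIntegral (A := B) (B := B) (K := L) (fun a ha => ha) ?_
    refine ⟨X ^ m - 1, monic_X_pow_sub_C (1 : B) hm.ne', ?_⟩
    simp [hζ.pow_eq_one]
  have hζ' : IsPrimitiveRoot (⟨ζ, hζB⟩ : B) m :=
    IsPrimitiveRoot.of_map_of_injective (f := B.subtype) hζ Subtype.val_injective
  refine ⟨residue B ⟨ζ, hζB⟩, (orderOf_eq_iff hm).mpr ⟨?_, ?_⟩⟩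
  · rw [← map_pow, hζ'.pow_eq_one, map_one]
  · intro j hj hj0 h
    obtain ⟨m, rfl⟩ := Nat.exists_eq_succ_of_ne_zero hm.ne'
    -- The product of 1 - ζ^i for 0 < i < m equals m. If ζ^j reduced to 1, this would make m vanish
    -- in the residue field.
    have h1 := congrArg (residue B) hζ'.prod_one_sub_pow_eq_order
    rw [map_prod] at h1
    refine hmB ?_
    have h2 : residue B ((m : B) + 1) = ((m.succ : ℕ) : ResidueField B) := by simp
    rw [← h2, ← h1]
    refine Finset.prod_eq_zero (i := j - 1) (Finset.mem_range.mpr (by omega)) ?_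
    rw [Nat.sub_add_cancel hj0, map_sub, map_one, map_pow, h, sub_self]

variable (K) in
-- N is the pointwise stabilizer of a finite extension E of the residue field k. Every automorphism
-- acts on E as a power of Frobenius; E is chosen large enough that N lies in U and that n divides
-- the order of Frobenius on E.
theorem hasFreeFrobenius [IsGalois K L] [IsSepClosed L]
    [Finite (ResidueField (B.comap (algebraMap K L)))] :
    HasFreeFrobenius (B.inertiaSubgroup K) := by
  let k := ResidueField (B.comap (algebraMap K L))
  let l := ResidueField B
  let Γ := B.decompositionSubgroup K
  have halg : Algebra.IsAlgebraic k l := isAlgebraic_residueField B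
  set q := Nat.card k with hq
  have hq2 : 2 ≤ q := Finite.one_lt_card
  obtain ⟨φ, hφ⟩ := exists_frobenius K B
  have hφi : ∀ (i : ℕ) (y : l), φ ^ i • y = y ^ q ^ i := by
    intro i
    induction i with
    | zero => simp
    | succ i ih =>
      intro y
      rw [pow_succ', mul_smul, ih, smul_pow', hφ, ← pow_mul, pow_succ, mul_comm]
  refine ⟨φ, fun n hn U hU hIU => ?_⟩
  have hqn : 1 < q ^ n := Nat.one_lt_pow hn.ne' hq2
  -- The cardinality q vanishes in the residue field, so q^n - 1 becomes -1 there.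
  have hmB : ((q ^ n - 1 : ℕ) : l) ≠ 0 := by
    have hq0 : (q : l) = 0 := by
      have : Fintype k := Fintype.ofFinite k
      have h := FiniteField.cast_card_eq_zero k
      rw [Fintype.card_eq_nat_card] at h
      rw [← map_natCast (algebraMap k l), h, map_zero]
    rw [Nat.cast_sub hqn.le, Nat.cast_pow, hq0, zero_pow hn.ne']
    simp
  obtain ⟨ζ, hζ⟩ := B.exists_orderOf_eq (Nat.sub_pos_of_lt hqn) hmB
  -- The stabilizers of residue classes intersect in the inertia group, which lies in U; by
  -- compactness finitely many of them already intersect inside U.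
  obtain ⟨t, ht⟩ := hU.isClosed_compl.isCompact.elim_finite_subfamily_closed
    (fun y : l => (MulAction.stabilizer Γ y : Set Γ))
    (fun y => Subgroup.isClosed_of_isOpen _ (isOpen_stabilizer_residueField B y)) (by
      rw [← Set.disjoint_iff_inter_eq_empty, Set.disjoint_compl_left_iff_subset]
      intro γ hγ
      exact hIU ((mem_inertiaSubgroup K B γ).mpr fun y => Set.mem_iInter.mp hγ y))
  let E : IntermediateField k l := IntermediateField.adjoin k (insert ζ (t : Set l))
  have hfin : Finite (insert ζ (t : Set l) : Set l) := (t.finite_toSet.insert ζ).to_subtype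
  have hE : FiniteDimensional k E :=
    IntermediateField.finiteDimensional_adjoin fun x _ => Algebra.IsIntegral.isIntegral x
  have hEfin : Finite E := Module.finite_of_finite k
  have hγ : ∀ γ : Γ, ∃ i : ℕ, ∀ y ∈ E, γ • y = y ^ q ^ i := fun γ =>
    exists_algEquiv_apply_eq_pow E (MulSemiringAction.toAlgAut Γ k l γ)
  let N : Subgroup Γ := fixingSubgroup Γ (E : Set l)
  have hN : ∀ γ : Γ, γ ∈ N ↔ ∀ y ∈ E, γ • y = y := fun γ => mem_fixingSubgroup_iff Γ
  refine ⟨N, ⟨fun ν hν γ => ?_⟩, ?_, ?_, ?_, ?_, ?_⟩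
  · rw [hN] at hν ⊢
    intro y hy
    -- Normality holds because γ⁻¹ acts on E as a power map and so preserves E.
    obtain ⟨i, hi⟩ := hγ γ⁻¹
    rw [mul_smul, mul_smul, hν _ (by rw [hi y hy]; exact pow_mem hy _), smul_inv_smul]
  · have : (N : Set Γ) = ⋂ y : E, (MulAction.stabilizer Γ (y : l) : Set Γ) := by
      ext γ
      simp only [SetLike.mem_coe, hN, Set.mem_iInter, MulAction.mem_stabilizer_iff, Subtype.forall]
    rw [this]
    exact isOpen_iInter_of_finite fun y => isOpen_stabilizer_residueField B _
  · exact fun γ hI => (hN γ).mpr fun y _ => (mem_inertiaSubgroup K B γ).mp hI y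
  · intro γ hγN
    by_contra hγU
    have : γ ∈ (∅ : Set Γ) := by
      rw [← ht]
      refine ⟨hγU, Set.mem_iInter₂.mpr fun y hy => ?_⟩
      exact (hN γ).mp hγN y (IntermediateField.subset_adjoin _ _ (Set.mem_insert_of_mem _ hy))
    exact this
  · intro γ
    obtain ⟨i, hi⟩ := hγ γ
    refine ⟨i, (hN _).mpr fun y hy => ?_⟩
    rw [mul_smul, hi y hy, ← hφi, inv_smul_smul]
  · intro i hi
    -- If φ^i fixes ζ, then ζ^(q^i - 1) = 1, so the order q^n - 1 of ζ divides q^i - 1, and hence n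
    -- divides i.
    have h1 := (hN _).mp hi ζ (IntermediateField.subset_adjoin _ _ (Set.mem_insert _ _))
    rw [hφi] at h1
    refine Nat.dvd_of_pow_sub_one_dvd hq2 ?_
    rw [← hζ, orderOf_dvd_iff_pow_eq_one]
    have hζ0 : ζ ≠ 0 := by
      rintro rfl
      have h2 : orderOf (0 : l) = 0 := orderOf_eq_zero_iff'.mpr fun j hj => by
        rw [zero_pow hj.ne']; exact zero_ne_one
      rw [h2] at hζ
      omega
    have hqi : 1 ≤ q ^ i := Nat.one_le_pow _ _ (by omega)
    refine mul_right_cancel₀ hζ0 ?_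
    rw [← pow_succ, Nat.sub_add_cancel hqi, h1, one_mul]

end ValuationSubring

/-! ### Inertia and étale polynomials -/

namespace ValuationSubring

open IsLocalRing Polynomial

variable {K L : Type*} [Field K] [Field L] [Algebra K L] (B : ValuationSubring L)

theorem smul_sub_mem_nonunits_of_mem_inertiaSubgroup {γ : B.decompositionSubgroup K}
    (hγ : γ ∈ B.inertiaSubgroup K) (x : B) : γ • x - x ∈ maximalIdeal B := by
  rw [← residue_eq_zero_iff, map_sub, ResidueField.residue_smul,
    (mem_inertiaSubgroup K B γ).mp hγ, sub_self]

/-- The inertia group fixes the root of a polynomial that is étale over the valuation subring. -/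
theorem apply_eq_of_mem_inertiaSubgroup {f g : K[X]} {θ : L} (hθ : IsIntegral K θ)
    (hf : f = minpoly K θ) (hg : aeval θ (g * derivative f) = 1)
    (hfB : ∀ i, f.coeff i ∈ B.comap (algebraMap K L))
    (hgB : ∀ i, g.coeff i ∈ B.comap (algebraMap K L)) {γ : B.decompositionSubgroup K}
    (hγ : γ ∈ B.inertiaSubgroup K) : (γ : Gal(L/K)) θ = θ := by
  set A := B.comap (algebraMap K L) with hA
  have hfl : f ∈ lifts (algebraMap A K) :=
    (lifts_iff_coeff_lifts f).mpr fun i => ⟨⟨_, hfB i⟩, rfl⟩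
  have hgl : g ∈ lifts (algebraMap A K) :=
    (lifts_iff_coeff_lifts g).mpr fun i => ⟨⟨_, hgB i⟩, rfl⟩
  obtain ⟨f', hf', -, hf'm⟩ := lifts_and_degree_eq_and_monic hfl (hf ▸ minpoly.monic hθ)
  obtain ⟨g', hg'⟩ := (mem_lifts g).mp hgl
  have hev : ∀ (p : A[X]) (x : B), ((eval₂ (comapHom K B) x p : B) : L) =
      aeval (x : L) (p.map (algebraMap A K)) := fun p x => by
    rw [aeval_def, eval₂_map]
    exact hom_eval₂ p (comapHom K B) B.subtype x
  have hfθ : aeval θ f = 0 := hf ▸ minpoly.aeval K θ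
  have hθB : θ ∈ B := mem_of_isIntegral (A := A) (B := B) (fun a ha => ha)
    ⟨f', hf'm, by rw [← hfθ, ← hf', aeval_def, eval₂_map]; rfl⟩
  let t : B := ⟨θ, hθB⟩
  let P : B[X] := f'.map (comapHom K B)
  have hP : ∀ x : B, ((P.eval x : B) : L) = aeval (x : L) f := fun x => by
    rw [Polynomial.eval_map, hev, hf']
  have h1 : P.eval t = 0 := Subtype.val_injective ((hP t).trans hfθ)
  have h2 : P.eval (γ • t) = 0 := Subtype.val_injective ((hP _).trans (by
    change aeval ((γ : Gal(L/K)) θ) f = 0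
    rw [show (γ : Gal(L/K)) θ = (γ : Gal(L/K)).toAlgHom θ from rfl, aeval_algHom_apply, hfθ,
      map_zero]))
  have h3 : (g'.map (comapHom K B)).eval t * (derivative P).eval t = 1 := by
    apply Subtype.val_injective
    change ((_ : B) : L) * ((_ : B) : L) = 1
    rw [← hg, map_mul, derivative_map, Polynomial.eval_map, Polynomial.eval_map, hev, hev,
      ← derivative_map, hg', hf']
  -- Both t and γt are roots of P, and their difference δ lies in the maximal ideal. If δ ≠ 0, the
  -- expansion of P at t gives P'(t) = -cδ, contradicting that P'(t) is a unit by the Bézout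
  -- identity.
  obtain ⟨c, hc⟩ := P.binomExpansion t (γ • t - t)
  rw [add_sub_cancel, h1, h2, zero_add] at hc
  by_contra hne
  have hδ : γ • t - t ≠ 0 := fun h => hne (congrArg Subtype.val (sub_eq_zero.mp h))
  have h4 : (derivative P).eval t = -(c * (γ • t - t)) := by
    refine mul_right_cancel₀ hδ ?_
    linear_combination -hc
  have h5 : (1 : B) ∈ maximalIdeal B := by
    rw [← h3, h4]
    exact Ideal.mul_mem_left _ _ (NegMemClass.neg_mem (Ideal.mul_mem_left _ _
      (smul_sub_mem_nonunits_of_mem_inertiaSubgroup B hγ t)))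
  exact (Ideal.ne_top_iff_one _).mp (maximalIdeal.isMaximal B).ne_top h5

end ValuationSubring

/-! ### Properties of almost all places of a global field -/

namespace Selmerable

variable {F : Type u} [Field F] {Fs : Type v} [Field Fs] [Algebra F Fs]

/-- The exceptions are among the finitely many archimedean places and the valuation subrings missing
one of finitely many elements. -/
theorem IsGlobalField.eventually_place (hF : IsGlobalField F) (p : Place F → Prop) {s : Set F}
    (hs : s.Finite)
    (h : ∀ (A : ValuationSubring F) (hA : A ≠ ⊤), s ⊆ A → p (.nonarchimedean A hA)) :
    ∀ᶠ v in Filter.cofinite, p v := by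
  have := hF.finite_infinitePlace
  have hfin := hs.biUnion fun x _ => hF.isArithmetic.finite_notMem x
  rw [Filter.eventually_cofinite]
  have hinj : Function.Injective fun v : Place F =>
      match v with
      | .archimedean w => (Sum.inl w : NumberField.InfinitePlace F ⊕ ValuationSubring F)
      | .nonarchimedean A _ => Sum.inr A := by
    rintro (w | ⟨A, hA⟩) (w' | ⟨A', hA'⟩) h <;> simp_all
  refine Set.Finite.of_finite_image (Set.Finite.subset
    ((Set.finite_range Sum.inl).union (hfin.image Sum.inr)) ?_) hinj.injOn
  rintro _ ⟨v, hv, rfl⟩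
  rcases v with w | ⟨A, hA⟩
  · exact Or.inl ⟨w, rfl⟩
  · refine Or.inr ⟨A, ?_, rfl⟩
    have : ¬ s ⊆ A := fun hsA => hv (h A hA hsA)
    obtain ⟨x, hx, hxA⟩ := Set.not_subset.mp this
    exact Set.mem_biUnion hx ⟨hA, hxA⟩

theorem Place.hasFreeFrobenius [IsSepClosure F Fs] (hF : IsGlobalField F) {w : Place Fs}
    {A : ValuationSubring F} {hA : A ≠ ⊤} (hw : w.LiesOver (.nonarchimedean A hA)) :
    HasFreeFrobenius (w.inertiaGroup F) := by
  rcases w with w | ⟨B, hB⟩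
  · exact hw.elim
  · have h : B.comap (algebraMap F Fs) = A := hw
    have := hF.isArithmetic.finite_residueField (B.comap (algebraMap F Fs)) (h ▸ hA)
    have := IsSepClosure.sep_closed (k := F) (K := Fs)
    exact B.hasFreeFrobenius F

theorem Place.apply_eq_of_mem_inertiaGroup {w : Place Fs} {A : ValuationSubring F} {hA : A ≠ ⊤}
    (hw : w.LiesOver (.nonarchimedean A hA)) {f g : Polynomial F} {θ : Fs} (hθ : IsIntegral F θ)
    (hf : f = minpoly F θ) (hg : Polynomial.aeval θ (g * Polynomial.derivative f) = 1)
    (hfA : ∀ i, f.coeff i ∈ A) (hgA : ∀ i, g.coeff i ∈ A) {γ : w.decompositionGroup F}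
    (hγ : γ ∈ w.inertiaGroup F) : (γ : Gal(Fs/F)) θ = θ := by
  rcases w with w | ⟨B, hB⟩
  · exact hw.elim
  · have h : B.comap (algebraMap F Fs) = A := hw
    subst h
    exact B.apply_eq_of_mem_inertiaSubgroup hθ hf hg hfA hgA hγ

theorem PlaceExtension.eventually_hasFreeFrobenius [IsSepClosure F Fs] (hF : IsGlobalField F)
    (P : PlaceExtension F Fs) : ∀ᶠ v in Filter.cofinite, HasFreeFrobenius (P.I v) :=
  hF.eventually_place _ Set.finite_empty fun A hA _ =>
    Place.hasFreeFrobenius hF (P.liesOver (.nonarchimedean A hA))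

theorem PlaceExtension.eventually_mem_fixingSubgroup [IsSepClosure F Fs] (hF : IsGlobalField F)
    (P : PlaceExtension F Fs) (E : IntermediateField F Fs) [FiniteDimensional F E] :
    ∀ᶠ v in Filter.cofinite, ∀ γ ∈ P.I v, (γ : Gal(Fs/F)) ∈ E.fixingSubgroup := by
  obtain ⟨θ, hθ⟩ := Field.exists_primitive_element F E
  have hint : IsIntegral F (θ : Fs) := Algebra.IsIntegral.isIntegral _
  -- Separability of the minimal polynomial f is a Bézout identity af + bf' = 1. At valuation
  -- subrings containing the coefficients of f and b, inertia fixes θ.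
  obtain ⟨a, b, hab⟩ := Algebra.IsSeparable.isSeparable F (θ : Fs)
  have hb : Polynomial.aeval (θ : Fs) (b * Polynomial.derivative (minpoly F (θ : Fs))) = 1 := by
    have := congrArg (Polynomial.aeval (θ : Fs)) hab
    rwa [map_add, map_mul, minpoly.aeval, mul_zero, zero_add, map_one] at this
  refine hF.eventually_place _
    ((minpoly F (θ : Fs)).coeffs.finite_toSet.union b.coeffs.finite_toSet) fun A hA hs γ hγ => ?_
  have key : ∀ p : Polynomial F, (p.coeffs : Set F) ⊆ A → ∀ i, p.coeff i ∈ A := fun p hp i => by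
    by_cases hi : p.coeff i = 0
    · rw [hi]; exact zero_mem A
    · exact hp (Polynomial.coeff_mem_coeffs hi)
  have hfix := Place.apply_eq_of_mem_inertiaGroup (P.liesOver (.nonarchimedean A hA)) hint rfl hb
    (key _ (Set.subset_union_left.trans hs)) (key _ (Set.subset_union_right.trans hs)) hγ
  have hE : E = IntermediateField.adjoin F {(θ : Fs)} := by
    have := congrArg (IntermediateField.map E.val) hθ
    rw [IntermediateField.adjoin_map] at this
    simpa [← AlgHom.fieldRange_eq_map] using this.symm
  rw [hE]
  intro x
  have := (IntermediateField.forall_mem_adjoin_smul_eq_self_iff F (S := {(θ : Fs)})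
    (γ : Gal(Fs/F))).mpr (by simpa using hfix)
  exact this x x.2

/-- The action on a finite discrete module is trivial on the fixing subgroup of some finite
subextension. -/
theorem PlaceExtension.eventually_smul_eq [IsSepClosure F Fs] (hF : IsGlobalField F)
    (P : PlaceExtension F Fs) (M : Type w) [AddCommGroup M] [TopologicalSpace M]
    [DiscreteTopology M] [DistribMulAction Gal(Fs/F) M] [ContinuousSMul Gal(Fs/F) M] [Finite M] :
    ∀ᶠ v in Filter.cofinite, ∀ γ ∈ P.I v, ∀ m : M, γ • m = m := by
  have h : (⋂ m : M, (MulAction.stabilizer Gal(Fs/F) m : Set Gal(Fs/F))) ∈ nhds 1 :=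
    (isOpen_iInter_of_finite fun m => stabilizer_isOpen Gal(Fs/F) m).mem_nhds
      (Set.mem_iInter.mpr fun m => one_smul _ m)
  obtain ⟨E, hE, hEs⟩ := (krullTopology_mem_nhds_one_iff F Fs _).mp h
  filter_upwards [P.eventually_mem_fixingSubgroup hF E] with v hv γ hγ m
  exact Set.mem_iInter.mp (hEs (hv γ hγ)) m

end Selmerable

/-! ### Continuous first cohomology in exact sequences -/

namespace Selmerable

section Cohomology

variable {Γ : Type*} [Group Γ] [TopologicalSpace Γ]
variable {M : Type*} [AddCommGroup M] [TopologicalSpace M] [DiscreteTopology M]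
  [DistribMulAction Γ M] [ContinuousSMul Γ M]
variable {N : Type*} [AddCommGroup N] [TopologicalSpace N] [DiscreteTopology N]
  [DistribMulAction Γ N] [ContinuousSMul Γ N]
variable {Y : Type*} [AddCommGroup Y] [TopologicalSpace Y] [DiscreteTopology Y]
  [DistribMulAction Γ Y] [ContinuousSMul Γ Y]
variable {X : Type*} [AddCommGroup X] [TopologicalSpace X] [DiscreteTopology X]
  [DistribMulAction Γ X] [ContinuousSMul Γ X]

theorem H1.mk_eq_zero_iff {z : Z1 Γ M} : H1.mk Γ z = 0 ↔ ∃ m : M, coboundary Γ M m = z :=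
  QuotientAddGroup.eq_zero_iff z

theorem H1.mk_eq_mk_iff {z z' : Z1 Γ M} :
    H1.mk Γ z = H1.mk Γ z' ↔ ∃ m : M, coboundary Γ M m = z - z' := by
  rw [← sub_eq_zero, ← map_sub, H1.mk_eq_zero_iff]

theorem H1.res_mk_eq_zero_iff {K : Subgroup Γ} (hK : ∀ γ ∈ K, ∀ m : M, γ • m = m) {z : Z1 Γ M} :
    H1.res K (H1.mk Γ z) = 0 ↔ ∀ γ ∈ K, z.1 γ = 0 := by
  change H1.mk K _ = 0 ↔ _
  rw [H1.mk_eq_zero_iff]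
  constructor
  · rintro ⟨m, hm⟩ γ hγ
    have := congrFun (congrArg Subtype.val hm) ⟨γ, hγ⟩
    refine this.symm.trans ?_
    change γ • m - m = 0
    rw [hK γ hγ, sub_self]
  · intro h
    refine ⟨0, Subtype.ext (funext fun γ => ?_)⟩
    rw [map_zero]
    exact (h γ γ.2).symm

section Finiteness

/-- Classes with prescribed images under two jointly injective maps form a finite set. -/
theorem H1.finite_setOf_map_eq [Finite M] [Finite N] (f : X →+ M)
    (hf : ∀ (σ : Γ) (x : X), f (σ • x) = σ • f x) (g : X →+ N)
    (hg : ∀ (σ : Γ) (x : X), g (σ • x) = σ • g x)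
    (hfg : ∀ x, f x = 0 → g x = 0 → x = 0) (a : H1 Γ M) (b : H1 Γ N) :
    {x : H1 Γ X | H1.map f hf x = a ∧ H1.map g hg x = b}.Finite := by
  have hker : {x : H1 Γ X | H1.map f hf x = 0 ∧ H1.map g hg x = 0}.Finite := by
    -- A cocycle whose images are the coboundaries of m and n is determined by the pair (m, n), by
    -- joint injectivity; there are finitely many pairs.
    let T := {z : Z1 Γ X // ∃ mn : M × N, coboundary Γ M mn.1 = Z1.map f hf z ∧
      coboundary Γ N mn.2 = Z1.map g hg z}
    have : Finite T := by
      refine Finite.of_injective (fun z : T => z.2.choose) fun z z' h => ?_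
      have h1 := z.2.choose_spec
      have h2 := z'.2.choose_spec
      simp only at h
      rw [← h] at h2
      refine Subtype.ext (Subtype.ext (funext fun σ => sub_eq_zero.mp (hfg _ ?_ ?_)))
      · rw [map_sub, sub_eq_zero]
        exact congrFun (congrArg Subtype.val (h1.1.symm.trans h2.1)) σ
      · rw [map_sub, sub_eq_zero]
        exact congrFun (congrArg Subtype.val (h1.2.symm.trans h2.2)) σ
    refine (Set.finite_range fun z : T => H1.mk Γ z.1).subset ?_
    rintro x ⟨h1, h2⟩
    induction x using H1.induction_on with | h z =>
    rw [H1.map_mk, H1.mk_eq_zero_iff] at h1 h2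
    obtain ⟨m, hm⟩ := h1
    obtain ⟨n, hn⟩ := h2
    exact ⟨⟨z, (m, n), hm, hn⟩, rfl⟩
  rcases Set.eq_empty_or_nonempty {x : H1 Γ X | H1.map f hf x = a ∧ H1.map g hg x = b} with
    h | ⟨x₀, h1, h2⟩
  · rw [h]; exact Set.finite_empty
  · refine (hker.image (x₀ + ·)).subset ?_
    rintro x ⟨h3, h4⟩
    refine ⟨x - x₀, ⟨?_, ?_⟩, add_sub_cancel _ _⟩
    · rw [map_sub, h1, h3, sub_self]
    · rw [map_sub, h2, h4, sub_self]

/-- Joint injectivity makes K act trivially on X too. For trivial actions a restricted class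
vanishes exactly when its cocycle does, which is tested after f and g. -/
theorem H1.res_eq_zero_of_map {K : Subgroup Γ} (hM : ∀ γ ∈ K, ∀ m : M, γ • m = m)
    (hN : ∀ γ ∈ K, ∀ n : N, γ • n = n) (f : X →+ M)
    (hf : ∀ (σ : Γ) (x : X), f (σ • x) = σ • f x) (g : X →+ N)
    (hg : ∀ (σ : Γ) (x : X), g (σ • x) = σ • g x)
    (hfg : ∀ x, f x = 0 → g x = 0 → x = 0) {x : H1 Γ X}
    (h1 : H1.res K (H1.map f hf x) = 0) (h2 : H1.res K (H1.map g hg x) = 0) :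
    H1.res K x = 0 := by
  have hX : ∀ γ ∈ K, ∀ x : X, γ • x = x := fun γ hγ x => sub_eq_zero.mp (hfg _
    (by rw [map_sub, hf, hM γ hγ, sub_self]) (by rw [map_sub, hg, hN γ hγ, sub_self]))
  induction x using H1.induction_on with | h z =>
  rw [H1.map_mk, H1.res_mk_eq_zero_iff hM] at h1
  rw [H1.map_mk, H1.res_mk_eq_zero_iff hN] at h2
  rw [H1.res_mk_eq_zero_iff hX]
  exact fun γ hγ => hfg _ (h1 γ hγ) (h2 γ hγ)

end Finiteness

/-- `H¹` of a fibre product surjects onto the fibre product of the `H¹`. -/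
theorem H1.exists_map_eq_of_fiberProduct (π : M →+ Y) (hπ : ∀ (σ : Γ) (m : M), π (σ • m) = σ • π m)
    (hπs : Function.Surjective π) (f : N →+ Y) (hf : ∀ (σ : Γ) (n : N), f (σ • n) = σ • f n)
    (p : X →+ M) (hp : ∀ (σ : Γ) (x : X), p (σ • x) = σ • p x) (r : X →+ N)
    (hr : ∀ (σ : Γ) (x : X), r (σ • x) = σ • r x) (hpr : ∀ x, p x = 0 → r x = 0 → x = 0)
    (hX : ∀ m n, π m = f n → ∃ x, p x = m ∧ r x = n) {a : H1 Γ M} {b : H1 Γ N}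
    (hab : H1.map π hπ a = H1.map f hf b) :
    ∃ x : H1 Γ X, H1.map p hp x = a ∧ H1.map r hr x = b := by
  induction a using H1.induction_on with | h z =>
  induction b using H1.induction_on with | h y =>
  rw [H1.map_mk, H1.map_mk, H1.mk_eq_mk_iff] at hab
  obtain ⟨m₀, hm₀⟩ := hab
  obtain ⟨m, rfl⟩ := hπs m₀
  -- The images of z and y differ by a coboundary, which lifts to M because π is surjective;
  -- removing it makes the cocycles agree on the nose.
  let z' : Z1 Γ M := z - coboundary Γ M m
  have hz' : ∀ σ, π (z'.1 σ) = f (y.1 σ) := fun σ => by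
    have h : σ • π m - π m = π (z.1 σ) - f (y.1 σ) := congrFun (congrArg Subtype.val hm₀) σ
    change π (z.1 σ - (σ • m - m)) = _
    rw [map_sub, map_sub, hπ, h, sub_sub_cancel]
  choose x hx1 hx2 using fun σ => hX _ _ (hz' σ)
  have hext : ∀ x x' : X, p x = p x' → r x = r x' → x = x' := fun x x' h h' =>
    sub_eq_zero.mp (hpr _ (by rw [map_sub, h, sub_self]) (by rw [map_sub, h', sub_self]))
  have hcont : Continuous x := by
    -- x is determined by its two components, so it is locally constant where they are.
    have hc : Continuous fun σ => (z'.1 σ, y.1 σ) := z'.2.1.prodMk y.2.1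
    refine (IsLocallyConstant.iff_continuous x).mp ?_
    refine (IsLocallyConstant.iff_exists_open x).mpr fun σ => ?_
    refine ⟨_, (isOpen_discrete {(z'.1 σ, y.1 σ)}).preimage hc, rfl, fun τ hτ => ?_⟩
    have h := Set.mem_singleton_iff.mp hτ
    rw [Prod.mk.injEq] at h
    exact hext _ _ (by rw [hx1, hx1, h.1]) (by rw [hx2, hx2, h.2])
  let w : Z1 Γ X := ⟨x, hcont, fun σ τ => hext _ _
    (by rw [map_add, hp, hx1, hx1, hx1, z'.2.2]) (by rw [map_add, hr, hx2, hx2, hx2, y.2.2])⟩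
  refine ⟨H1.mk Γ w, ?_, ?_⟩
  · rw [H1.map_mk, show Z1.map p hp w = z' from Subtype.ext (funext hx1)]
    exact H1.mk_eq_mk_iff.mpr ⟨-m, by rw [map_neg]; simp [z']⟩
  · rw [H1.map_mk, show Z1.map r hr w = y from Subtype.ext (funext hx2)]

/-- Exactness of `H¹(X) → H¹(M) → H¹(N)` for an exact sequence `0 → X → M → N → 0`. -/
theorem H1.exists_map_eq_of_map_eq_zero (i : X →+ M)
    (hi : ∀ (σ : Γ) (x : X), i (σ • x) = σ • i x) (hinj : Function.Injective i) (q : M →+ N)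
    (hq : ∀ (σ : Γ) (m : M), q (σ • m) = σ • q m) (hsurj : Function.Surjective q)
    (hex : ∀ m, q m = 0 → ∃ x, i x = m) {a : H1 Γ M} (ha : H1.map q hq a = 0) :
    ∃ x : H1 Γ X, H1.map i hi x = a := by
  -- The kernel X is the fibre product of M and the trivial module over N.
  obtain ⟨x, hx, -⟩ := H1.exists_map_eq_of_fiberProduct (N := PUnit.{1}) q hq hsurj 0
    (fun σ _ => (smul_zero σ).symm) i hi 0 (fun _ _ => rfl)
    (fun x h _ => hinj (h.trans (map_zero i).symm))
    (fun m n h => (hex m h).imp fun x hx => ⟨hx, rfl⟩) (a := a) (b := 0) (by rw [ha, map_zero])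
  exact ⟨x, hx⟩

/-- Unramified classes lift along surjections. -/
theorem H1.exists_map_eq_of_hasFreeFrobenius [IsTopologicalGroup Γ] {I : Subgroup Γ}
    (hI : HasFreeFrobenius I) [Finite M] (hIM : ∀ γ ∈ I, ∀ m : M, γ • m = m) (q : M →+ N)
    (hq : ∀ (σ : Γ) (m : M), q (σ • m) = σ • q m) (hsurj : Function.Surjective q) {b : H1 Γ N}
    (hb : H1.res I b = 0) : ∃ a : H1 Γ M, H1.res I a = 0 ∧ H1.map q hq a = b := by
  have hIN : ∀ γ ∈ I, ∀ n : N, γ • n = n := fun γ hγ n => by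
    obtain ⟨m, rfl⟩ := hsurj n
    rw [← hq, hIM γ hγ]
  induction b using H1.induction_on with | h z =>
  rw [H1.res_mk_eq_zero_iff hIN] at hb
  obtain ⟨φ, hφ⟩ := hI
  have hz1 : z.1 1 = 0 := by
    have := z.2.2 1 1
    rw [one_smul, mul_one] at this
    exact left_eq_add.mp this
  -- The part of the kernel of the action on M where z vanishes: a subgroup that matters neither for
  -- the action nor for the cocycle.
  let U : Subgroup Γ :=
    { carrier := {γ | (∀ m : M, γ • m = m) ∧ z.1 γ = 0}
      one_mem' := ⟨one_smul Γ, hz1⟩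
      mul_mem' := by
        rintro γ δ ⟨h1, h2⟩ ⟨h3, h4⟩
        exact ⟨fun m => by rw [mul_smul, h3, h1], by rw [z.2.2, h2, h4, smul_zero, add_zero]⟩
      inv_mem' := by
        rintro γ ⟨h1, h2⟩
        refine ⟨fun m => by rw [inv_smul_eq_iff, h1], ?_⟩
        have := z.2.2 γ⁻¹ γ
        rw [inv_mul_cancel, hz1, h2, smul_zero, add_zero] at this
        exact this.symm }
  have hU : IsOpen (U : Set Γ) := by
    have : (U : Set Γ) =
        (⋂ m : M, (MulAction.stabilizer Γ m : Set Γ)) ∩ z.1 ⁻¹' {0} := by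
      ext γ
      simp [U]
    rw [this]
    exact (isOpen_iInter_of_finite fun m => stabilizer_isOpen Γ m).inter
      ((isOpen_discrete _).preimage z.2.1)
  obtain ⟨m₀, hm₀⟩ := hsurj (z.1 φ)
  -- The value at φ^i forced on any cocycle taking the value m₀ at φ.
  let s : ℕ → M := fun i => ∑ j ∈ Finset.range i, φ ^ j • m₀
  have hs : ∀ i j, s (i + j) = s i + φ ^ i • s j := fun i j => by
    simp only [s, Finset.sum_range_add, Finset.smul_sum, pow_add, mul_smul]
  -- With e the order of φ on M, s(ek) = k s(e), so s vanishes at the multiples of n = e |M|. Since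
  -- φ^k ∈ V implies n ∣ k, the value s(i) depends only on the class of φ^i modulo V.
  obtain ⟨n, hn, hsn⟩ : ∃ n, 0 < n ∧ ∀ i, n ∣ i → s i = 0 := by
    let e := orderOf (MulAction.toPermHom Γ M φ)
    have he : 0 < e := orderOf_pos _
    have hφe : ∀ m : M, φ ^ e • m = m := fun m => by
      have := congrArg (fun f : Equiv.Perm M => f m)
        (pow_orderOf_eq_one (MulAction.toPermHom Γ M φ))
      rwa [← map_pow] at this
    have h1 : ∀ k, s (e * k) = k • s e := fun k => by
      induction k with
      | zero => simp [s]
      | succ k ih =>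
        rw [mul_add, mul_one, add_comm, hs, ih, hφe, add_smul, one_smul, add_comm]
    refine ⟨e * Nat.card M, Nat.mul_pos he Nat.card_pos, ?_⟩
    rintro _ ⟨k, rfl⟩
    rw [mul_assoc, h1, mul_smul, card_nsmul_eq_zero']
  obtain ⟨V, hVn, hVo, hIV, hVU, hgen, hdvd⟩ := hφ n hn U hU fun γ hγ => ⟨hIM γ hγ, hb γ hγ⟩
  have hwd : ∀ {γ : Γ} {i j : ℕ}, (φ ^ i)⁻¹ * γ ∈ V → (φ ^ j)⁻¹ * γ ∈ V → s i = s j := by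
    intro γ
    have aux : ∀ {i j : ℕ}, i ≤ j → (φ ^ i)⁻¹ * γ ∈ V → (φ ^ j)⁻¹ * γ ∈ V → s i = s j := by
      intro i j hij hi hj
      obtain ⟨k, rfl⟩ := Nat.exists_eq_add_of_le hij
      have h := mul_mem hi (inv_mem hj)
      rw [show (φ ^ i)⁻¹ * γ * ((φ ^ (i + k))⁻¹ * γ)⁻¹ = φ ^ k by rw [pow_add]; group] at h
      rw [hs, hsn k (hdvd k h), smul_zero, add_zero]
    intro i j hi hj
    rcases le_total i j with h | h
    exacts [aux h hi hj, (aux h hj hi).symm]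
  choose i hi using hgen
  have hsmul : ∀ γ (m : M), γ • m = φ ^ i γ • m := fun γ m => by
    conv_lhs => rw [← mul_inv_cancel_left (φ ^ i γ) γ, mul_smul, (hVU (hi γ)).1 m]
  have hcont : Continuous fun γ => s (i γ) := by
    refine (IsLocallyConstant.iff_continuous _).mp ?_
    refine (IsLocallyConstant.iff_exists_open _).mpr fun γ => ?_
    refine ⟨(fun δ => (φ ^ i γ)⁻¹ * δ) ⁻¹' (V : Set Γ),
      hVo.preimage (continuous_const.mul continuous_id), hi γ, fun δ hδ => hwd (hi δ) hδ⟩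
  let y : Z1 Γ M := ⟨fun γ => s (i γ), hcont, fun γ δ => by
    rw [hsmul, ← hs]
    refine hwd (hi _) ?_
    -- Normality of V shows that γδ is congruent to φ^(i γ + i δ), so the cocycle identity reduces
    -- to the one for s.
    have h := mul_mem (hVn.conj_mem _ (hi γ) (φ ^ i δ)⁻¹) (hi δ)
    rwa [show (φ ^ i δ)⁻¹ * ((φ ^ i γ)⁻¹ * γ) * (φ ^ i δ)⁻¹⁻¹ * ((φ ^ i δ)⁻¹ * δ) =
      (φ ^ (i γ + i δ))⁻¹ * (γ * δ) by rw [pow_add]; group] at h⟩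
  refine ⟨H1.mk Γ y, ?_, ?_⟩
  · rw [H1.res_mk_eq_zero_iff hIM]
    intro γ hγ
    refine (hwd (hi γ) (j := 0) (by simpa using hIV hγ)).trans ?_
    simp [s]
  · rw [H1.map_mk]
    congr 1
    refine Subtype.ext (funext fun γ => ?_)
    have hqs : ∀ j, q (s j) = z.1 (φ ^ j) := fun j => by
      induction j with
      | zero => simp [s, hz1]
      | succ j ih =>
        rw [hs, map_add, ih, hq, pow_succ, z.2.2]
        simp [s, hm₀]
    change q (s (i γ)) = _
    conv_rhs => rw [← mul_inv_cancel_left (φ ^ i γ) γ, z.2.2, (hVU (hi γ)).2]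
    rw [hqs, smul_zero, add_zero]

end Cohomology

end Selmerable

/-! ### Compact and open subgroups of the restricted product -/

namespace RestrictedProduct

open Filter Topology

variable {ι : Type*} {R : ι → Type*} {A : (i : ι) → Set (R i)} [∀ i, TopologicalSpace (R i)]

/-- The set lies in the piece with integral coordinates wherever C i ⊆ A i. That piece carries the
product topology, so Tychonoff applies, and its inclusion is continuous. -/
theorem isCompact_setOf_forall_mem {C : (i : ι) → Set (R i)} (hC : ∀ i, IsCompact (C i))
    (hCA : ∀ᶠ i in cofinite, C i ⊆ A i) : IsCompact {x : Πʳ i, [R i, A i] | ∀ i, x i ∈ C i} := by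
  set S : Set ι := {i | C i ⊆ A i}
  have hS : cofinite ≤ 𝓟 S := le_principal_iff.mpr hCA
  have hK : IsCompact {x : Πʳ i, [R i, A i]_[𝓟 S] | ∀ i, x i ∈ C i} := by
    rw [isEmbedding_coe_of_principal.isInducing.isCompact_iff]
    convert isCompact_univ_pi hC using 1
    ext x
    constructor
    · rintro ⟨y, hy, rfl⟩ i -
      exact hy i
    · exact fun hx => ⟨⟨x, fun i hi => hi (hx i trivial)⟩, fun i => hx i trivial, rfl⟩
  convert hK.image (continuous_inclusion hS) using 1
  ext x
  constructor
  · exact fun hx => ⟨⟨x, fun i hi => hi (hx i)⟩, hx, rfl⟩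
  · rintro ⟨y, hy, rfl⟩
    exact hy

/-- The open sets of points integral outside a finite set T form a directed cover, so one of them
contains W. -/
theorem eventually_forall_mem_of_isCompact (hA : ∀ i, IsOpen (A i)) {W : Set (Πʳ i, [R i, A i])}
    (hW : IsCompact W) : ∀ᶠ i in cofinite, ∀ x ∈ W, x i ∈ A i := by
  let U : Finset ι → Set (Πʳ i, [R i, A i]) := fun T => {x | ∀ i, i ∉ T → x i ∈ A i}
  have hcov : W ⊆ ⋃ T, U T := fun x _ => by
    have hx : {i | x i ∉ A i}.Finite := x.eventually
    exact Set.mem_iUnion.mpr ⟨hx.toFinset, fun i hi => by simpa using hi⟩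
  have hdir : Directed (· ⊆ ·) U := by
    classical
    exact fun T T' => ⟨T ∪ T', fun x hx i hi => hx i fun h => hi (Finset.mem_union_left _ h),
      fun x hx i hi => hx i fun h => hi (Finset.mem_union_right _ h)⟩
  obtain ⟨T, hT⟩ := hW.elim_directed_cover U (fun T => isOpen_forall_imp_mem hA) hcov hdir
  exact T.finite_toSet.subset fun i hi => by
    by_contra hn
    exact hi fun x hx => hT hx i hn

end RestrictedProduct

namespace Selmerable

open Filter Topology

variable {F : Type u} [Field F] {Fs : Type v} [Field Fs] [Algebra F Fs] (P : PlaceExtension F Fs)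
variable {M : Type*} [AddCommGroup M] [TopologicalSpace M] [DiscreteTopology M]
  [DistribMulAction Gal(Fs/F) M] [ContinuousSMul Gal(Fs/F) M]
variable {N : Type*} [AddCommGroup N] [TopologicalSpace N] [DiscreteTopology N]
  [DistribMulAction Gal(Fs/F) N] [ContinuousSMul Gal(Fs/F) N]
variable {Y : Type*} [AddCommGroup Y] [TopologicalSpace Y] [DiscreteTopology Y]
  [DistribMulAction Gal(Fs/F) Y] [ContinuousSMul Gal(Fs/F) Y]
variable {X : Type*} [AddCommGroup X] [TopologicalSpace X] [DiscreteTopology X]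
  [DistribMulAction Gal(Fs/F) X] [ContinuousSMul Gal(Fs/F) X]

instance : Fact (∀ v, IsOpen (unramified P M v : Set (H1 (P.G v) M))) :=
  ⟨fun _ => isOpen_discrete _⟩

theorem continuous_localMap (f : M →+ N) (hf : ∀ (σ : Gal(Fs/F)) (m : M), f (σ • m) = σ • f m) :
    Continuous (localMap P f hf) :=
  RestrictedProduct.mapAlong_continuous (fun v => H1 (P.G v) M) (fun v => H1 (P.G v) N) id
    Filter.tendsto_id (fun v => H1.map (Γ := P.G v) f (fun σ m => hf σ m))
    (Filter.Eventually.of_forall fun v x hx => by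
      change H1.res _ (H1.map _ _ x) = 0
      rw [H1.res_map, show H1.res (P.I v) x = 0 from hx, map_zero])
    fun _ => continuous_of_discreteTopology

/-- Choosing an unramified local solution whenever there is one makes the family a point of the
restricted product. -/
theorem exists_localH1 {p : (v : Place F) → H1 (P.G v) M → Prop} (h : ∀ v, ∃ x, p v x)
    (h' : ∀ᶠ v in cofinite, ∃ x ∈ unramified P M v, p v x) : ∃ x : LocalH1 P M, ∀ v, p v (x v) := by
  classical
  let x : (v : Place F) → H1 (P.G v) M := fun v =>
    if hv : ∃ x ∈ unramified P M v, p v x then hv.choose else (h v).choose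
  refine ⟨⟨x, h'.mono fun v hv => ?_⟩, fun v => ?_⟩
  · simp only [x, dif_pos hv]
    exact hv.choose_spec.1
  · change p v (x v)
    by_cases hv : ∃ x ∈ unramified P M v, p v x
    · simp only [x, dif_pos hv]
      exact hv.choose_spec.2
    · simp only [x, dif_neg hv]
      exact (h v).choose_spec

variable [IsSepClosure F Fs] (hF : IsGlobalField F)

include hF in
/-- The image of an open subgroup under a surjection of coefficients is open. -/
theorem isOpen_map_localMap [Finite M] (q : M →+ N)
    (hq : ∀ (σ : Gal(Fs/F)) (m : M), q (σ • m) = σ • q m) (hsurj : Function.Surjective q)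
    {W : AddSubgroup (LocalH1 P M)} (hW : IsOpen (W : Set (LocalH1 P M))) :
    IsOpen (W.map (localMap P q hq) : Set (LocalH1 P N)) := by
  have hgood : ∀ᶠ v in cofinite, ∀ y ∈ unramified P N v, ∃ x ∈ unramified P M v,
      H1.map (Γ := P.G v) q (fun σ m => hq σ m) x = y := by
    filter_upwards [P.eventually_hasFreeFrobenius hF, P.eventually_smul_eq hF M] with v h1 h2 y hy
    exact H1.exists_map_eq_of_hasFreeFrobenius h1 h2 q _ hsurj hy
  have hW0 : (W : Set (LocalH1 P M)) ∈ 𝓝 (0 : LocalH1 P M) := hW.mem_nhds W.zero_mem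
  have hM := RestrictedProduct.nhds_zero_eq_map_structureMap
    (R := fun v => H1 (P.G v) M) (B := fun v => unramified P M v) fun _ => isOpen_discrete _
  have hN := RestrictedProduct.nhds_zero_eq_map_structureMap
    (R := fun v => H1 (P.G v) N) (B := fun v => unramified P N v) fun _ => isOpen_discrete _
  change 𝓝 (0 : LocalH1 P M) = _ at hM
  change 𝓝 (0 : LocalH1 P N) = _ at hN
  refine AddSubgroup.isOpen_of_mem_nhds _ (g := 0) ?_
  rw [hM, mem_map, nhds_pi, mem_pi] at hW0
  obtain ⟨I, hI, t, ht, htW⟩ := hW0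
  rw [hN, mem_map, nhds_pi, mem_pi]
  -- A neighbourhood of 0 in the image: unramified families vanishing at the places of I, where W
  -- imposes conditions, and at the places where unramified lifting may fail. The lift is taken to
  -- be 0 there.
  refine ⟨I ∪ {v | ¬ _}, hI.union hgood, fun v => {0}, fun v => ?_, fun y hy => ?_⟩
  · exact (isOpen_discrete {(0 : unramified P N v)}).mem_nhds rfl
  · have hex : ∀ v, ∃ x : unramified P M v, (v ∈ I → x = 0) ∧
        H1.map (Γ := P.G v) q (fun σ m => hq σ m) x.1 = (y v).1 := fun v => by
      by_cases hv : v ∈ I ∪ {v | ¬ ∀ y ∈ unramified P N v, ∃ x ∈ unramified P M v,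
          H1.map (Γ := P.G v) q (fun σ m => hq σ m) x = y}
      · refine ⟨0, fun _ => rfl, ?_⟩
        rw [show y v = 0 from hy v hv]
        exact map_zero _
      · rw [Set.mem_union, not_or] at hv
        obtain ⟨x, hx, hxy⟩ := not_not.mp hv.2 _ (y v).2
        exact ⟨⟨x, hx⟩, fun h => absurd h hv.1, hxy⟩
    choose x hx0 hxy using hex
    refine ⟨RestrictedProduct.structureMap _ _ _ x, htW fun v hv => ?_, ?_⟩
    · rw [hx0 v hv]; exact mem_of_mem_nhds (ht v)
    · exact RestrictedProduct.ext _ _ fun v => hxy v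

include hF in
/-- The joint preimage of compact open subgroups under jointly injective maps of coefficients
is compact. -/
theorem isCompact_comap_localMap [Finite M] [Finite N] (f : X →+ M)
    (hf : ∀ (σ : Gal(Fs/F)) (x : X), f (σ • x) = σ • f x) (g : X →+ N)
    (hg : ∀ (σ : Gal(Fs/F)) (x : X), g (σ • x) = σ • g x)
    (hfg : ∀ x, f x = 0 → g x = 0 → x = 0) {W : AddSubgroup (LocalH1 P M)}
    (hW : IsCompact (W : Set (LocalH1 P M))) (hWo : IsOpen (W : Set (LocalH1 P M)))
    {V : AddSubgroup (LocalH1 P N)} (hV : IsCompact (V : Set (LocalH1 P N)))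
    (hVo : IsOpen (V : Set (LocalH1 P N))) :
    IsCompact (W.comap (localMap P f hf) ⊓ V.comap (localMap P g hg) : Set (LocalH1 P X)) := by
  -- A box containing the joint preimage. Its factors are finite since W and V have finite
  -- projections, and almost all are unramified since W and V are unramified at almost all places.
  let C : (v : Place F) → Set (H1 (P.G v) X) := fun v =>
    {x | H1.map (Γ := P.G v) f (fun σ m => hf σ m) x ∈ (fun y : LocalH1 P M => y v) '' W ∧
      H1.map (Γ := P.G v) g (fun σ m => hg σ m) x ∈ (fun y : LocalH1 P N => y v) '' V}
  have hCfin : ∀ v, (C v).Finite := fun v => by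
    have h1 := (hW.image (RestrictedProduct.continuous_eval v)).finite_of_discrete
    have h2 := (hV.image (RestrictedProduct.continuous_eval v)).finite_of_discrete
    refine ((h1.prod h2).biUnion fun ab _ => H1.finite_setOf_map_eq (Γ := P.G v) f
      (fun σ m => hf σ m) g (fun σ m => hg σ m) hfg ab.1 ab.2).subset ?_
    rintro x ⟨h3, h4⟩
    exact Set.mem_biUnion (x := (_, _)) ⟨h3, h4⟩ ⟨rfl, rfl⟩
  have hCur : ∀ᶠ v in cofinite, C v ⊆ unramified P X v := by
    filter_upwards [P.eventually_smul_eq hF M, P.eventually_smul_eq hF N,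
      RestrictedProduct.eventually_forall_mem_of_isCompact (fun _ => isOpen_discrete _) hW,
      RestrictedProduct.eventually_forall_mem_of_isCompact (fun _ => isOpen_discrete _) hV]
      with v h1 h2 h3 h4
    rintro x ⟨⟨a, ha, hax⟩, ⟨b, hb, hbx⟩⟩
    refine H1.res_eq_zero_of_map h1 h2 f (fun σ m => hf σ m) g (fun σ m => hg σ m) hfg ?_ ?_
    · rw [← hax]; exact h3 a ha
    · rw [← hbx]; exact h4 b hb
  refine (RestrictedProduct.isCompact_setOf_forall_mem (fun v => (hCfin v).isCompact)
    hCur).of_isClosed_subset ?_ ?_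
  · exact ((W.isClosed_of_isOpen hWo).preimage (continuous_localMap P f hf)).inter
      ((V.isClosed_of_isOpen hVo).preimage (continuous_localMap P g hg))
  · rintro x ⟨h1, h2⟩ v
    exact ⟨⟨_, h1, rfl⟩, ⟨_, h2, rfl⟩⟩

include hF in
-- At almost all places a and b are unramified and inertia acts trivially, so any local lift is
-- unramified by joint injectivity.
theorem exists_localMap_eq_of_fiberProduct [Finite M] [Finite N] (π : M →+ Y)
    (hπ : ∀ (σ : Gal(Fs/F)) (m : M), π (σ • m) = σ • π m)
    (hπs : Function.Surjective π) (f : N →+ Y)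
    (hf : ∀ (σ : Gal(Fs/F)) (n : N), f (σ • n) = σ • f n)
    (p : X →+ M) (hp : ∀ (σ : Gal(Fs/F)) (x : X), p (σ • x) = σ • p x) (r : X →+ N)
    (hr : ∀ (σ : Gal(Fs/F)) (x : X), r (σ • x) = σ • r x) (hpr : ∀ x, p x = 0 → r x = 0 → x = 0)
    (hX : ∀ m n, π m = f n → ∃ x, p x = m ∧ r x = n) {a : LocalH1 P M} {b : LocalH1 P N}
    (hab : localMap P π hπ a = localMap P f hf b) :
    ∃ x : LocalH1 P X, localMap P p hp x = a ∧ localMap P r hr x = b := by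
  have hloc : ∀ v, ∃ x : H1 (P.G v) X, H1.map (Γ := P.G v) p (fun σ m => hp σ m) x = a v ∧
      H1.map (Γ := P.G v) r (fun σ m => hr σ m) x = b v := fun v =>
    H1.exists_map_eq_of_fiberProduct (Γ := P.G v) π (fun σ m => hπ σ m) hπs f
      (fun σ m => hf σ m) p (fun σ m => hp σ m) r (fun σ m => hr σ m) hpr hX
      congr($hab v)
  obtain ⟨x, hx⟩ := exists_localH1 P hloc (by
    filter_upwards [P.eventually_smul_eq hF M, P.eventually_smul_eq hF N, a.eventually,
      b.eventually] with v h1 h2 h3 h4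
    obtain ⟨x, hxa, hxb⟩ := hloc v
    refine ⟨x, H1.res_eq_zero_of_map h1 h2 p (fun σ m => hp σ m) r (fun σ m => hr σ m) hpr ?_ ?_,
      hxa, hxb⟩
    · rw [hxa]; exact h3
    · rw [hxb]; exact h4)
  exact ⟨x, RestrictedProduct.ext _ _ fun v => (hx v).1,
    RestrictedProduct.ext _ _ fun v => (hx v).2⟩

include hF in
theorem exists_localMap_eq_of_localMap_eq_zero [Finite M] (i : X →+ M)
    (hi : ∀ (σ : Gal(Fs/F)) (x : X), i (σ • x) = σ • i x) (hinj : Function.Injective i) (q : M →+ N)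
    (hq : ∀ (σ : Gal(Fs/F)) (m : M), q (σ • m) = σ • q m) (hsurj : Function.Surjective q)
    (hex : ∀ m, q m = 0 → ∃ x, i x = m) {a : LocalH1 P M} (ha : localMap P q hq a = 0) :
    ∃ x : LocalH1 P X, localMap P i hi x = a := by
  have hloc : ∀ v, ∃ x : H1 (P.G v) X, H1.map (Γ := P.G v) i (fun σ m => hi σ m) x = a v :=
    fun v => H1.exists_map_eq_of_map_eq_zero (Γ := P.G v) i (fun σ m => hi σ m) hinj q
      (fun σ m => hq σ m) hsurj hex congr($ha v)
  obtain ⟨x, hx⟩ := exists_localH1 P hloc (by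
    filter_upwards [P.eventually_smul_eq hF M, a.eventually] with v h1 h3
    obtain ⟨x, hxa⟩ := hloc v
    refine ⟨x, H1.res_eq_zero_of_map h1 h1 i (fun σ m => hi σ m) i (fun σ m => hi σ m)
      (fun x h _ => hinj (h.trans (map_zero i).symm)) ?_ ?_, hxa⟩ <;>
    · rw [hxa]; exact h3)
  exact ⟨x, RestrictedProduct.ext _ _ hx⟩

end Selmerable

/-! ### Limits and colimits of Selmerable modules -/

namespace Selmerable

theorem localMap_localMap {F : Type u} [Field F] {Fs : Type v} [Field Fs] [Algebra F Fs]
    (P : PlaceExtension F Fs) {M N X : Type*} [AddCommGroup M] [TopologicalSpace M]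
    [DiscreteTopology M] [DistribMulAction Gal(Fs/F) M] [ContinuousSMul Gal(Fs/F) M]
    [AddCommGroup N] [TopologicalSpace N] [DiscreteTopology N] [DistribMulAction Gal(Fs/F) N]
    [ContinuousSMul Gal(Fs/F) N] [AddCommGroup X] [TopologicalSpace X] [DiscreteTopology X]
    [DistribMulAction Gal(Fs/F) X] [ContinuousSMul Gal(Fs/F) X] (f : M →+ N)
    (hf : ∀ (σ : Gal(Fs/F)) (m : M), f (σ • m) = σ • f m) (g : N →+ X)
    (hg : ∀ (σ : Gal(Fs/F)) (n : N), g (σ • n) = σ • g n) (φ : LocalH1 P M) :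
    localMap P g hg (localMap P f hf φ) =
      localMap P (g.comp f) (fun σ m => by simp [hf, hg]) φ := by
  ext v
  rw [localMap_apply, localMap_apply, localMap_apply]
  induction φ v using H1.induction_on
  rfl

namespace SMod

variable {F : Type u} [Field F] {Fs : Type v} [Field Fs] [Algebra F Fs] {P : PlaceExtension F Fs}

section Morphisms

variable {X Y Z : SMod.{u, v, w} P}

@[simp]
theorem id_hom_apply (x : X.carrier) : Hom.hom (𝟙 X) x = x := rfl

@[simp]
theorem comp_hom_apply (f : X ⟶ Y) (g : Y ⟶ Z) (x : X.carrier) :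
    Hom.hom (f ≫ g) x = g.hom (f.hom x) := rfl

@[simp]
theorem zero_hom_apply (x : X.carrier) : Hom.hom (0 : X ⟶ Y) x = 0 := rfl

@[simp]
theorem add_hom_apply (f g : X ⟶ Y) (x : X.carrier) : Hom.hom (f + g) x = f.hom x + g.hom x := rfl

theorem hom_ext {f g : X ⟶ Y} (h : ∀ x, f.hom x = g.hom x) : f = g :=
  Hom.ext (AddMonoidHom.ext h)

theorem hom_congr {f g : X ⟶ Y} (h : f = g) (x : X.carrier) : f.hom x = g.hom x := by rw [h]

theorem locMap_mem (f : X ⟶ Y) {φ : LocalH1 P X.carrier} (hφ : φ ∈ X.W) : locMap f φ ∈ Y.W :=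
  f.map_W φ hφ

theorem locMap_id (φ : LocalH1 P X.carrier) : locMap (𝟙 X) φ = φ := localMap_id X φ

theorem locMap_comp (f : X ⟶ Y) (g : Y ⟶ Z) (φ : LocalH1 P X.carrier) :
    locMap (f ≫ g) φ = locMap g (locMap f φ) :=
  localMap_comp f.hom f.map_smul g.hom g.map_smul φ

theorem locMap_zero (φ : LocalH1 P X.carrier) : locMap (0 : X ⟶ Y) φ = 0 := localMap_zero X Y φ

/-- Injective morphisms whose source carries the preimage of the local conditions. -/
structure StrictInj (f : X ⟶ Y) : Prop where
  injective : Function.Injective f.hom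
  comap_W : Y.W.comap (locMap f) = X.W

/-- Surjective morphisms whose target carries the image of the local conditions. -/
structure StrictSurj (f : X ⟶ Y) : Prop where
  surjective : Function.Surjective f.hom
  map_W : X.W.map (locMap f) = Y.W

theorem StrictInj.of_iso (e : X ≅ Y) : StrictInj e.hom where
  injective x y h := by
    have := congrArg e.inv.hom h
    rwa [← comp_hom_apply, ← comp_hom_apply, e.hom_inv_id] at this
  comap_W := by
    ext φ
    refine ⟨fun h => ?_, fun h => locMap_mem _ h⟩
    have := locMap_mem e.inv h
    rwa [← locMap_comp, e.hom_inv_id, locMap_id] at this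

theorem StrictSurj.of_iso (e : X ≅ Y) : StrictSurj e.hom where
  surjective y := ⟨e.inv.hom y, by rw [← comp_hom_apply, e.inv_hom_id, id_hom_apply]⟩
  map_W := by
    ext φ
    refine ⟨?_, fun h => ⟨locMap e.inv φ, locMap_mem _ h, ?_⟩⟩
    · rintro ⟨ψ, hψ, rfl⟩
      exact locMap_mem _ hψ
    · rw [← locMap_comp, e.inv_hom_id, locMap_id]

theorem StrictInj.comp {f : X ⟶ Y} {g : Y ⟶ Z} (hf : StrictInj f) (hg : StrictInj g) :
    StrictInj (f ≫ g) where
  injective := hg.injective.comp hf.injective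
  comap_W := by
    ext φ
    rw [AddSubgroup.mem_comap, locMap_comp, ← hf.comap_W, ← hg.comap_W]
    rfl

theorem StrictSurj.comp {f : X ⟶ Y} {g : Y ⟶ Z} (hf : StrictSurj f) (hg : StrictSurj g) :
    StrictSurj (f ≫ g) where
  surjective := hg.surjective.comp hf.surjective
  map_W := by
    rw [← hg.map_W, ← hf.map_W, AddSubgroup.map_map]
    congr 1
    ext1 φ
    exact locMap_comp f g φ

/-- A morphism factors through a strict surjection if it vanishes on its kernel. -/
noncomputable def StrictSurj.desc {f : X ⟶ Y} (hf : StrictSurj f) (g : X ⟶ Z)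
    (h : ∀ x, f.hom x = 0 → g.hom x = 0) : Y ⟶ Z :=
  let d : Y.carrier →+ Z.carrier := AddMonoidHom.liftOfRightInverse f.hom _
    (Function.rightInverse_surjInv hf.surjective) ⟨g.hom, h⟩
  have hd : ∀ x, d (f.hom x) = g.hom x := AddMonoidHom.liftOfRightInverse_comp_apply _ _ _ _
  have hdσ : ∀ (σ : Gal(Fs/F)) y, d (σ • y) = σ • d y := fun σ y => by
    obtain ⟨x, rfl⟩ := hf.surjective y
    rw [← f.map_smul, hd, hd, g.map_smul]
  { hom := d
    map_smul := hdσ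
    map_W := fun φ hφ => by
      rw [← hf.map_W] at hφ
      obtain ⟨ψ, hψ, rfl⟩ := hφ
      change localMap P d hdσ (localMap P f.hom f.map_smul ψ) ∈ _
      rw [← localMap_comp]
      have h : d.comp f.hom = g.hom := AddMonoidHom.ext hd
      simp only [h]
      exact g.map_W ψ hψ }

theorem StrictSurj.comp_desc {f : X ⟶ Y} (hf : StrictSurj f) (g : X ⟶ Z)
    (h : ∀ x, f.hom x = 0 → g.hom x = 0) : f ≫ hf.desc g h = g :=
  hom_ext fun x => AddMonoidHom.liftOfRightInverse_comp_apply f.hom _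
    (Function.rightInverse_surjInv hf.surjective) ⟨g.hom, h⟩ x

theorem StrictSurj.epi {f : X ⟶ Y} (hf : StrictSurj f) : Epi f where
  left_cancellation g h hgh := hom_ext fun y => by
    obtain ⟨x, rfl⟩ := hf.surjective y
    exact hom_congr hgh x

/-- A morphism factors through a strict injection if it takes values in its range. -/
noncomputable def StrictInj.lift {f : Y ⟶ Z} (hf : StrictInj f) (g : X ⟶ Z)
    (h : ∀ x, ∃ y, f.hom y = g.hom x) : X ⟶ Y :=
  let d : X.carrier → Y.carrier := fun x => (h x).choose
  have hd : ∀ x, f.hom (d x) = g.hom x := fun x => (h x).choose_spec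
  let d' : X.carrier →+ Y.carrier :=
    { toFun := d
      map_zero' := hf.injective (by rw [hd, map_zero, map_zero])
      map_add' := fun x y => hf.injective (by rw [hd, map_add, map_add, hd, hd]) }
  have hdσ : ∀ (σ : Gal(Fs/F)) x, d' (σ • x) = σ • d' x := fun σ x => hf.injective (by
    change f.hom (d _) = f.hom (σ • d _)
    rw [f.map_smul, hd, hd, g.map_smul])
  { hom := d'
    map_smul := hdσ
    map_W := fun φ hφ => by
      rw [← hf.comap_W]
      change localMap P f.hom f.map_smul (localMap P d' hdσ φ) ∈ Z.W
      rw [← localMap_comp]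
      have h : f.hom.comp d' = g.hom := AddMonoidHom.ext hd
      simp only [h]
      exact g.map_W φ hφ }

theorem StrictInj.lift_comp {f : Y ⟶ Z} (hf : StrictInj f) (g : X ⟶ Z)
    (h : ∀ x, ∃ y, f.hom y = g.hom x) : hf.lift g h ≫ f = g :=
  hom_ext fun x => (h x).choose_spec

theorem StrictInj.mono {f : X ⟶ Y} (hf : StrictInj f) : Mono f where
  right_cancellation _ _ hgh := hom_ext fun x => hf.injective (hom_congr hgh x)

namespace ShortExact

variable {ι : X ⟶ Y} {π : Y ⟶ Z}

theorem strictInj (h : ShortExact ι π) : StrictInj ι := ⟨h.injective, h.comap_W⟩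

theorem strictSurj (h : ShortExact ι π) : StrictSurj π := ⟨h.surjective, h.map_W⟩

theorem zero (h : ShortExact ι π) : ι ≫ π = 0 := hom_ext fun x => (h.exact _).mpr ⟨x, rfl⟩

theorem isStrictEpi (h : ShortExact ι π) : IsStrictEpi π :=
  ⟨X, ι, h.zero, ⟨CokernelCofork.IsColimit.ofπ π h.zero
    (fun g hg => h.strictSurj.desc g fun y hy => by
      obtain ⟨x, rfl⟩ := (h.exact y).mp hy
      exact hom_congr hg x)
    (fun g _ => h.strictSurj.comp_desc g _)
    (fun g _ d hd => by
      have := h.strictSurj.epi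
      rw [← cancel_epi π, hd, h.strictSurj.comp_desc])⟩⟩

theorem isStrictMono (h : ShortExact ι π) : IsStrictMono ι :=
  ⟨Z, π, h.zero, ⟨KernelFork.IsLimit.ofι ι h.zero
    (fun g hg => h.strictInj.lift g fun x => (h.exact _).mp (hom_congr hg x))
    (fun g _ => h.strictInj.lift_comp g _)
    (fun g _ d hd => by
      have := h.strictInj.mono
      rw [← cancel_mono ι, hd, h.strictInj.lift_comp])⟩⟩

theorem of_iso {Y' : SMod.{u, v, w} P} {ι' : X ⟶ Y'} {π' : Y' ⟶ Z} (h : ShortExact ι' π')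
    (e : Y ≅ Y') (hι : ι ≫ e.hom = ι') (hπ : e.hom ≫ π' = π) : ShortExact ι π := by
  have hι' : ι = ι' ≫ e.inv := by rw [← hι, Category.assoc, e.hom_inv_id, Category.comp_id]
  have h1 : StrictInj ι := hι' ▸ h.strictInj.comp (StrictInj.of_iso e.symm)
  have h2 : StrictSurj π := hπ ▸ (StrictSurj.of_iso e).comp h.strictSurj
  refine ⟨h1.injective, fun y => ?_, h2.surjective, h1.comap_W, h2.map_W⟩
  rw [← hπ, comp_hom_apply, h.exact]
  refine exists_congr fun x => ?_
  rw [← hι, comp_hom_apply]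
  exact (StrictInj.of_iso e).injective.eq_iff

end ShortExact

end Morphisms

section Objects

theorem continuousSMul_of_stabilizer {G X : Type*} [Group G] [TopologicalSpace G]
    [IsTopologicalGroup G] [MulAction G X] [TopologicalSpace X] [DiscreteTopology X]
    (h : ∀ x : X, ∃ U : Subgroup G, IsOpen (U : Set G) ∧ ∀ g ∈ U, g • x = x) :
    ContinuousSMul G X :=
  continuousSMul_iff_stabilizer_isOpen.mpr fun x => by
    obtain ⟨U, hU, hUx⟩ := h x
    exact Subgroup.isOpen_mono hUx hU

variable (P) in
/-- The zero object. -/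
noncomputable def zeroObject : SMod.{u, v, w} P :=
  letI : DistribMulAction Gal(Fs/F) PUnit.{w + 1} :=
    { smul := fun _ x => x
      one_smul := fun _ => rfl
      mul_smul := fun _ _ _ => rfl
      smul_zero := fun _ => rfl
      smul_add := fun _ _ _ => rfl }
  haveI : ContinuousSMul Gal(Fs/F) PUnit.{w + 1} := ⟨continuous_const⟩
  haveI (v : Place F) : Subsingleton (H1 (P.G v) PUnit.{w + 1}) :=
    ⟨fun x y => by
      induction x using H1.induction_on
      induction y using H1.induction_on
      exact congrArg _ (Subtype.ext (funext fun _ => rfl))⟩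
  haveI : Subsingleton (LocalH1 P PUnit.{w + 1}) :=
    ⟨fun x y => RestrictedProduct.ext _ _ fun v => Subsingleton.elim _ _⟩
  { carrier := PUnit.{w + 1}
    not_dvd_card := by
      rw [Nat.card_unique, Nat.dvd_one]
      exact CharP.ringChar_ne_one
    W := ⊤
    isCompact := Set.subsingleton_of_subsingleton.isCompact
    isOpen := isOpen_univ }

theorem isZero_zeroObject : IsZero (zeroObject.{u, v, w} P) where
  unique_to _ := ⟨⟨⟨0⟩, fun f => hom_ext fun x => by
    rw [show x = 0 from rfl, map_zero, map_zero]⟩⟩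
  unique_from _ := ⟨⟨⟨0⟩, fun f => hom_ext fun _ => rfl⟩⟩

section Pullback

variable {X Y Z : SMod.{u, v, w} P} (f : X ⟶ Z) (g : Y ⟶ Z)

/-- The fibre product of the underlying modules. -/
def PullbackModule : Type w :=
  (AddMonoidHom.eqLocus (f.hom.comp (AddMonoidHom.fst _ _)) (g.hom.comp (AddMonoidHom.snd _ _)) :
    AddSubgroup (X.carrier × Y.carrier))

namespace PullbackModule

noncomputable instance : AddCommGroup (PullbackModule f g) :=
  inferInstanceAs (AddCommGroup (AddMonoidHom.eqLocus (f.hom.comp (AddMonoidHom.fst _ _))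
    (g.hom.comp (AddMonoidHom.snd _ _)) : AddSubgroup (X.carrier × Y.carrier)))

instance : TopologicalSpace (PullbackModule f g) := ⊥

instance : DiscreteTopology (PullbackModule f g) := ⟨rfl⟩

instance : Finite (PullbackModule f g) := Subtype.finite

/-- The first projection. -/
noncomputable def fst : PullbackModule f g →+ X.carrier :=
  (AddMonoidHom.fst _ _).comp (AddSubgroup.subtype _)

/-- The second projection. -/
noncomputable def snd : PullbackModule f g →+ Y.carrier :=
  (AddMonoidHom.snd _ _).comp (AddSubgroup.subtype _)

variable {f g}

theorem condition (x : PullbackModule f g) : f.hom (fst f g x) = g.hom (snd f g x) := x.2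

theorem ext {x y : PullbackModule f g} (h1 : fst f g x = fst f g y) (h2 : snd f g x = snd f g y) :
    x = y :=
  Subtype.ext (Prod.ext h1 h2)

/-- Elements of the fibre product. -/
def mk (x : X.carrier) (y : Y.carrier) (h : f.hom x = g.hom y) : PullbackModule f g := ⟨(x, y), h⟩

theorem eq_zero {x : PullbackModule f g} (h1 : fst f g x = 0) (h2 : snd f g x = 0) : x = 0 :=
  ext (h1.trans (map_zero _).symm) (h2.trans (map_zero _).symm)

variable (f g)

noncomputable instance : DistribMulAction Gal(Fs/F) (PullbackModule f g) where
  smul σ x := mk (σ • fst f g x) (σ • snd f g x) (by rw [f.map_smul, g.map_smul, condition])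
  one_smul x := ext (one_smul _ _) (one_smul _ _)
  mul_smul σ τ x := ext (mul_smul σ τ _) (mul_smul σ τ _)
  smul_zero σ := ext (smul_zero σ) (smul_zero σ)
  smul_add σ x y := ext (smul_add σ _ _) (smul_add σ _ _)

theorem fst_smul (σ : Gal(Fs/F)) (x : PullbackModule f g) :
    fst f g (σ • x) = σ • fst f g x := rfl

theorem snd_smul (σ : Gal(Fs/F)) (x : PullbackModule f g) :
    snd f g (σ • x) = σ • snd f g x := rfl

instance : ContinuousSMul Gal(Fs/F) (PullbackModule f g) :=
  continuousSMul_of_stabilizer fun x =>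
    ⟨MulAction.stabilizer _ (fst f g x) ⊓ MulAction.stabilizer _ (snd f g x),
      (stabilizer_isOpen _ _).inter (stabilizer_isOpen _ _), fun _ h => ext h.1 h.2⟩

end PullbackModule

variable [IsSepClosure F Fs] (hF : IsGlobalField F)

/-- The fibre product of Selmerable modules. -/
noncomputable def pullbackObject : SMod.{u, v, w} P where
  carrier := PullbackModule f g
  not_dvd_card h := by
    have h1 : Nat.card (PullbackModule f g) ∣ Nat.card (X.carrier × Y.carrier) :=
      AddSubgroup.card_addSubgroup_dvd_card _
    rw [Nat.card_prod] at h1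
    have h2 := h.trans h1
    rcases CharP.char_is_prime_or_zero F (ringChar F) with hp | hp
    · rcases hp.dvd_mul.mp h2 with h3 | h3
      exacts [X.not_dvd_card h3, Y.not_dvd_card h3]
    -- In characteristic zero the divisibility would say that a finite nonempty module has
    -- cardinality zero.
    · rw [hp, zero_dvd_iff, mul_eq_zero] at h2
      rcases h2 with h3 | h3
      exacts [Nat.card_pos.ne' h3, Nat.card_pos.ne' h3]
  W := X.W.comap (localMap P (PullbackModule.fst f g) (PullbackModule.fst_smul f g)) ⊓
    Y.W.comap (localMap P (PullbackModule.snd f g) (PullbackModule.snd_smul f g))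
  isCompact := isCompact_comap_localMap P hF _ _ _ _ (fun _ => PullbackModule.eq_zero)
    X.isCompact X.isOpen Y.isCompact Y.isOpen
  isOpen := (X.isOpen.preimage (continuous_localMap P _ _)).inter
    (Y.isOpen.preimage (continuous_localMap P _ _))

/-- The first projection. -/
noncomputable def pullbackObject.fst : pullbackObject f g hF ⟶ X :=
  ⟨PullbackModule.fst f g, PullbackModule.fst_smul f g, fun _ h => h.1⟩

/-- The second projection. -/
noncomputable def pullbackObject.snd : pullbackObject f g hF ⟶ Y :=
  ⟨PullbackModule.snd f g, PullbackModule.snd_smul f g, fun _ h => h.2⟩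

variable {f g} in
/-- The morphism to the fibre product given by two compatible morphisms. -/
noncomputable def pullbackObject.lift {T : SMod.{u, v, w} P} (a : T ⟶ X) (b : T ⟶ Y)
    (h : a ≫ f = b ≫ g) : T ⟶ pullbackObject f g hF :=
  let d : T.carrier →+ PullbackModule f g :=
    { toFun := fun t => PullbackModule.mk (a.hom t) (b.hom t) (hom_congr h t)
      map_zero' := PullbackModule.ext (map_zero a.hom) (map_zero b.hom)
      map_add' := fun x y => PullbackModule.ext (map_add a.hom x y) (map_add b.hom x y) }
  have hd : ∀ (σ : Gal(Fs/F)) x, d (σ • x) = σ • d x := fun σ x =>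
    PullbackModule.ext (a.map_smul σ x) (b.map_smul σ x)
  ⟨d, hd, fun φ hφ => ⟨by
      change localMap P (PullbackModule.fst f g) _ (localMap P d hd φ) ∈ X.W
      rw [localMap_localMap]
      exact a.map_W φ hφ, by
      change localMap P (PullbackModule.snd f g) _ (localMap P d hd φ) ∈ Y.W
      rw [localMap_localMap]
      exact b.map_W φ hφ⟩⟩

theorem pullbackObject.isPullback : IsPullback (fst f g hF) (snd f g hF) f g where
  w := hom_ext PullbackModule.condition
  isLimit' := ⟨PullbackCone.IsLimit.mk _ (fun s => lift hF s.fst s.snd s.condition)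
    (fun _ => rfl) (fun _ => rfl) (fun _ _ h1 h2 => hom_ext fun t =>
      PullbackModule.ext (hom_congr h1 t) (hom_congr h2 t))⟩

end Pullback

end Objects

end SMod

end Selmerable

/-! ### Quotients, kernels, cokernels and strict morphisms -/

namespace Selmerable

namespace SMod

variable {F : Type u} [Field F] {Fs : Type v} [Field Fs] [Algebra F Fs] {P : PlaceExtension F Fs}

section Quotient

variable (Y : SMod.{u, v, w} P) (H : AddSubgroup Y.carrier)
  (hH : ∀ (σ : Gal(Fs/F)), ∀ m ∈ H, σ • m ∈ H)

/-- The quotient of the underlying module by a stable subgroup. -/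
def QuotientModule (_ : ∀ (σ : Gal(Fs/F)), ∀ m ∈ H, σ • m ∈ H) : Type w := Y.carrier ⧸ H

namespace QuotientModule

noncomputable instance : AddCommGroup (QuotientModule Y H hH) :=
  inferInstanceAs (AddCommGroup (Y.carrier ⧸ H))

instance : TopologicalSpace (QuotientModule Y H hH) := ⊥

instance : DiscreteTopology (QuotientModule Y H hH) := ⟨rfl⟩

/-- The projection. -/
noncomputable def mk : Y.carrier →+ QuotientModule Y H hH := QuotientAddGroup.mk' H

theorem mk_surjective : Function.Surjective (mk Y H hH) := QuotientAddGroup.mk'_surjective H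

theorem mk_eq_zero_iff (y : Y.carrier) : mk Y H hH y = 0 ↔ y ∈ H :=
  QuotientAddGroup.eq_zero_iff y

instance : Finite (QuotientModule Y H hH) := Finite.of_surjective _ (mk_surjective Y H hH)

/-- The action of an element of the Galois group. -/
noncomputable def act (σ : Gal(Fs/F)) : QuotientModule Y H hH →+ QuotientModule Y H hH :=
  QuotientAddGroup.map H H (DistribSMul.toAddMonoidHom Y.carrier σ) fun m hm => hH σ m hm

noncomputable instance : DistribMulAction Gal(Fs/F) (QuotientModule Y H hH) where
  smul σ x := act Y H hH σ x
  one_smul x := by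
    obtain ⟨y, rfl⟩ := mk_surjective Y H hH x
    exact congrArg (mk Y H hH) (one_smul _ y)
  mul_smul σ τ x := by
    obtain ⟨y, rfl⟩ := mk_surjective Y H hH x
    exact congrArg (mk Y H hH) (mul_smul σ τ y)
  smul_zero σ := map_zero (act Y H hH σ)
  smul_add σ := map_add (act Y H hH σ)

theorem mk_smul (σ : Gal(Fs/F)) (y : Y.carrier) : mk Y H hH (σ • y) = σ • mk Y H hH y := rfl

instance : ContinuousSMul Gal(Fs/F) (QuotientModule Y H hH) :=
  continuousSMul_of_stabilizer fun x => by
    obtain ⟨y, rfl⟩ := mk_surjective Y H hH x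
    exact ⟨MulAction.stabilizer _ y, stabilizer_isOpen _ _, fun σ hσ =>
      congrArg (mk Y H hH) hσ⟩

end QuotientModule

variable [IsSepClosure F Fs] (hF : IsGlobalField F)

/-- The quotient of a Selmerable module by a stable subgroup. -/
noncomputable def quotientObject : SMod.{u, v, w} P where
  carrier := QuotientModule Y H hH
  not_dvd_card h := Y.not_dvd_card (h.trans (AddSubgroup.card_quotient_dvd_card H))
  W := Y.W.map (localMap P (QuotientModule.mk Y H hH) (QuotientModule.mk_smul Y H hH))
  isCompact := Y.isCompact.image (continuous_localMap P _ _)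
  isOpen := isOpen_map_localMap P hF _ _ (QuotientModule.mk_surjective Y H hH) Y.isOpen

/-- The projection to the quotient. -/
noncomputable def quotientObject.mk : Y ⟶ quotientObject Y H hH hF :=
  ⟨QuotientModule.mk Y H hH, QuotientModule.mk_smul Y H hH, fun φ hφ => ⟨φ, hφ, rfl⟩⟩

theorem quotientObject.strictSurj_mk : StrictSurj (mk Y H hH hF) :=
  ⟨QuotientModule.mk_surjective Y H hH, rfl⟩

variable {Y H hH hF} in
theorem quotientObject.mk_hom_eq_zero_iff {y : Y.carrier} : (mk Y H hH hF).hom y = 0 ↔ y ∈ H :=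
  QuotientModule.mk_eq_zero_iff Y H hH y

end Quotient

section Strict

variable [IsSepClosure F Fs] (hF : IsGlobalField F) {X Y Z : SMod.{u, v, w} P}

/-- The cokernel of a morphism. -/
noncomputable def cokernelObject (f : X ⟶ Y) : SMod.{u, v, w} P :=
  quotientObject Y f.hom.range (by
    rintro σ _ ⟨x, rfl⟩
    exact ⟨σ • x, f.map_smul σ x⟩) hF

/-- The projection to the cokernel of a morphism. -/
noncomputable def cokernelObject.mk (f : X ⟶ Y) : Y ⟶ cokernelObject hF f :=
  quotientObject.mk _ _ _ _

theorem cokernelObject.strictSurj_mk (f : X ⟶ Y) : StrictSurj (mk hF f) :=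
  quotientObject.strictSurj_mk _ _ _ _

variable {hF} in
theorem cokernelObject.mk_hom_eq_zero_iff {f : X ⟶ Y} {y : Y.carrier} :
    (mk hF f).hom y = 0 ↔ ∃ x, f.hom x = y :=
  quotientObject.mk_hom_eq_zero_iff

theorem cokernelObject.comp_mk (f : X ⟶ Y) : f ≫ mk hF f = 0 :=
  hom_ext fun x => mk_hom_eq_zero_iff.mpr ⟨x, rfl⟩

theorem cokernelObject.eq_zero {f : X ⟶ Y} {g : Y ⟶ Z} (h : f ≫ g = 0) (y : Y.carrier)
    (hy : (mk hF f).hom y = 0) : g.hom y = 0 := by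
  obtain ⟨x, rfl⟩ := mk_hom_eq_zero_iff.mp hy
  exact hom_congr h x

/-- The universal property of the cokernel. -/
noncomputable def cokernelObject.isColimit (f : X ⟶ Y) :
    IsColimit (CokernelCofork.ofπ (mk hF f) (comp_mk hF f)) :=
  CokernelCofork.IsColimit.ofπ _ _ (fun g hg => (strictSurj_mk hF f).desc g (eq_zero hF hg))
    (fun g hg => (strictSurj_mk hF f).comp_desc g (eq_zero hF hg))
    (fun g hg d hd => by
      have := (strictSurj_mk hF f).epi
      rw [← cancel_epi (mk hF f), hd, (strictSurj_mk hF f).comp_desc])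

theorem StrictInj.shortExact {f : X ⟶ Y} (hf : StrictInj f) :
    ShortExact f (cokernelObject.mk hF f) where
  injective := hf.injective
  exact _ := cokernelObject.mk_hom_eq_zero_iff
  surjective := (cokernelObject.strictSurj_mk hF f).surjective
  comap_W := hf.comap_W
  map_W := (cokernelObject.strictSurj_mk hF f).map_W

/-- The inclusion of the kernel of a morphism. -/
noncomputable def kernelMap (f : X ⟶ Y) :
    pullbackObject f (0 : zeroObject P ⟶ Y) hF ⟶ X :=
  pullbackObject.fst _ _ _

theorem kernelMap_strictInj (f : X ⟶ Y) : StrictInj (kernelMap hF f) where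
  injective _ _ h := PullbackModule.ext h rfl
  comap_W := by
    ext φ
    -- The zero object carries the whole group as local conditions, so the second factor imposes
    -- nothing.
    exact ⟨fun h => ⟨h, trivial⟩, fun h => h.1⟩

variable {hF} in
theorem exists_kernelMap_eq_iff {f : X ⟶ Y} {x : X.carrier} :
    (∃ y, (kernelMap hF f).hom y = x) ↔ f.hom x = 0 := by
  constructor
  · rintro ⟨y, rfl⟩
    exact PullbackModule.condition y
  · exact fun h => ⟨PullbackModule.mk x 0 h, rfl⟩

theorem kernelMap_comp (f : X ⟶ Y) : kernelMap hF f ≫ f = 0 :=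
  hom_ext fun y => exists_kernelMap_eq_iff (f := f).mp ⟨y, rfl⟩

/-- The universal property of the kernel. -/
noncomputable def kernelMapIsLimit (f : X ⟶ Y) :
    IsLimit (KernelFork.ofι (kernelMap hF f) (kernelMap_comp hF f)) :=
  KernelFork.IsLimit.ofι _ _
    (fun g hg => (kernelMap_strictInj hF f).lift g fun x =>
      exists_kernelMap_eq_iff.mpr (hom_congr hg x))
    (fun g _ => (kernelMap_strictInj hF f).lift_comp g _)
    (fun g _ d hd => by
      have := (kernelMap_strictInj hF f).mono
      rw [← cancel_mono (kernelMap hF f), hd, (kernelMap_strictInj hF f).lift_comp])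

theorem StrictSurj.shortExact {f : X ⟶ Y} (hf : StrictSurj f) : ShortExact (kernelMap hF f) f where
  injective := (kernelMap_strictInj hF f).injective
  exact _ := exists_kernelMap_eq_iff.symm
  surjective := hf.surjective
  comap_W := (kernelMap_strictInj hF f).comap_W
  map_W := hf.map_W

/-- A cokernel is isomorphic to the explicit quotient, which carries the image. Conversely, a strict
surjection is the cokernel of its kernel. -/
theorem isStrictEpi_iff_strictSurj {f : X ⟶ Y} (hF : IsGlobalField F) :
    IsStrictEpi f ↔ StrictSurj f := by
  refine ⟨?_, fun h => (h.shortExact hF).isStrictEpi⟩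
  rintro ⟨Z, g, h, ⟨hc⟩⟩
  let e := (cokernelObject.isColimit hF g).coconePointUniqueUpToIso hc
  have he : cokernelObject.mk hF g ≫ e.hom = f :=
    (cokernelObject.isColimit hF g).comp_coconePointUniqueUpToIso_hom hc
      WalkingParallelPair.one
  rw [← he]
  exact (cokernelObject.strictSurj_mk hF g).comp (StrictSurj.of_iso e)

theorem isStrictMono_iff_strictInj {f : X ⟶ Y} (hF : IsGlobalField F) :
    IsStrictMono f ↔ StrictInj f := by
  refine ⟨?_, fun h => (h.shortExact hF).isStrictMono⟩
  rintro ⟨Z, g, h, ⟨hc⟩⟩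
  let e := hc.conePointUniqueUpToIso (kernelMapIsLimit hF g)
  have he : e.hom ≫ kernelMap hF g = f :=
    hc.conePointUniqueUpToIso_hom_comp (kernelMapIsLimit hF g) WalkingParallelPair.zero
  rw [← he]
  exact (StrictInj.of_iso e).comp (kernelMap_strictInj hF g)

theorem hasKernels (hF : IsGlobalField F) : HasKernels (SMod.{u, v, w} P) :=
  ⟨fun {_ _} f => ⟨⟨⟨_, kernelMapIsLimit hF f⟩⟩⟩⟩

theorem hasCokernels (hF : IsGlobalField F) : HasCokernels (SMod.{u, v, w} P) :=
  ⟨fun {_ _} f => ⟨⟨⟨_, cokernelObject.isColimit hF f⟩⟩⟩⟩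

theorem hasFiniteBiproducts (hF : IsGlobalField F) : HasFiniteBiproducts (SMod.{u, v, w} P) := by
  have : HasPullbacks (SMod.{u, v, w} P) :=
    have (X Y Z : SMod.{u, v, w} P) (f : X ⟶ Z) (g : Y ⟶ Z) : HasLimit (cospan f g) :=
      (pullbackObject.isPullback f g hF).hasPullback
    hasPullbacks_of_hasLimit_cospan _
  have : HasTerminal (SMod.{u, v, w} P) := isZero_zeroObject.isTerminal.hasTerminal
  have := hasFiniteLimits_of_hasTerminal_and_pullbacks (C := SMod.{u, v, w} P)
  exact HasFiniteBiproducts.of_hasFiniteProducts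

end Strict

/-! ### Pullbacks of short exact sequences -/

section PullbackExact

variable {M₁ M M₂ : SMod.{u, v, w} P} {ι : M₁ ⟶ M} {π : M ⟶ M₂}

theorem ShortExact.pullbackObject [IsSepClosure F Fs] (hF : IsGlobalField F) (h : ShortExact ι π)
    {N₂ : SMod.{u, v, w} P} (f : N₂ ⟶ M₂) :
    ShortExact (pullbackObject.lift hF ι (0 : M₁ ⟶ N₂) (by rw [h.zero, zero_comp]))
      (pullbackObject.snd π f hF) where
  injective x y hxy := h.injective (congrArg (PullbackModule.fst π f) hxy)
  exact x := by
    constructor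
    · intro hx
      obtain ⟨y, hy⟩ := (h.exact _).mp ((PullbackModule.condition x).trans
        ((congrArg f.hom hx).trans (map_zero _)))
      exact ⟨y, PullbackModule.ext hy hx.symm⟩
    · rintro ⟨y, rfl⟩
      rfl
  surjective y := by
    obtain ⟨x, hx⟩ := h.surjective (f.hom y)
    exact ⟨PullbackModule.mk x y hx, rfl⟩
  comap_W := by
    ext φ
    refine ⟨fun hφ => ?_, fun hφ => AddSubgroup.mem_comap.mpr (locMap_mem _ hφ)⟩
    have := locMap_mem (pullbackObject.fst π f hF) hφ
    rw [← locMap_comp] at this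
    rw [← h.comap_W]
    exact this
  map_W := by
    ext φ
    constructor
    · rintro ⟨ψ, hψ, rfl⟩
      exact locMap_mem _ hψ
    · intro hφ
      have h1 := locMap_mem f hφ
      rw [← h.map_W] at h1
      obtain ⟨ψ, hψ, hψφ⟩ := h1
      -- ψ and φ have the same image over M₂, so they come from one class on the fibre product; it
      -- meets the local conditions because both its projections do.
      obtain ⟨χ, hχ1, hχ2⟩ := exists_localMap_eq_of_fiberProduct P hF π.hom π.map_smul
        h.surjective f.hom f.map_smul (PullbackModule.fst π f) (PullbackModule.fst_smul π f)
        (PullbackModule.snd π f) (PullbackModule.snd_smul π f)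
        (fun _ => PullbackModule.eq_zero) (fun m n hmn => ⟨PullbackModule.mk m n hmn, rfl, rfl⟩)
        hψφ
      refine ⟨χ, ⟨?_, ?_⟩, hχ2⟩
      · change localMap P _ _ χ ∈ M.W
        rw [hχ1]
        exact hψ
      · change localMap P _ _ χ ∈ N₂.W
        rw [hχ2]
        exact hφ

theorem ShortExact.of_isPullback [IsSepClosure F Fs] (hF : IsGlobalField F) (h : ShortExact ι π)
    {N N₂ : SMod.{u, v, w} P} {f : N₂ ⟶ M₂} {p : N ⟶ M} {πN : N ⟶ N₂}
    (hN : IsPullback p πN π f) {ιN : M₁ ⟶ N} (h1 : ιN ≫ p = ι)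
    (h2 : ιN ≫ πN = 0) : ShortExact ιN πN := by
  have hN' := pullbackObject.isPullback π f hF
  refine (h.pullbackObject hF f).of_iso (hN.isoIsPullback _ _ hN') ?_
    (hN.isoIsPullback_hom_snd _ _ hN')
  apply hN'.hom_ext
  · rw [Category.assoc, hN.isoIsPullback_hom_fst, h1]
    rfl
  · rw [Category.assoc, hN.isoIsPullback_hom_snd, h2]
    rfl

theorem ShortExact.existsUnique_of_isPullback (h : ShortExact ι π) {N N₂ : SMod.{u, v, w} P}
    {f : N₂ ⟶ M₂} {p : N ⟶ M} {πN : N ⟶ N₂} (hN : IsPullback p πN π f) :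
    ∃! ιN : M₁ ⟶ N, ιN ≫ p = ι ∧ ιN ≫ πN = 0 :=
  ⟨hN.lift ι 0 (by rw [h.zero, zero_comp]), ⟨hN.lift_fst _ _ _, hN.lift_snd _ _ _⟩,
    fun _ hd => hN.hom_ext (by rw [hd.1, hN.lift_fst]) (by rw [hd.2, hN.lift_snd])⟩

theorem ShortExact.existsUnique_of_isPushout (h : ShortExact ι π) {N N₁ : SMod.{u, v, w} P}
    {g : M₁ ⟶ N₁} {q : M ⟶ N} {ιN : N₁ ⟶ N} (hN : IsPushout ι g q ιN) :
    ∃! πN : N ⟶ M₂, q ≫ πN = π ∧ ιN ≫ πN = 0 :=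
  ⟨hN.desc π 0 (by rw [h.zero, comp_zero]), ⟨hN.inl_desc _ _ _, hN.inr_desc _ _ _⟩,
    fun _ hd => hN.hom_ext (by rw [hd.1, hN.inl_desc]) (by rw [hd.2, hN.inr_desc])⟩

end PullbackExact

end SMod

end Selmerable

/-! ### Products, pushouts and the quasi-abelian structure -/

namespace Selmerable

namespace SMod

variable {F : Type u} [Field F] {Fs : Type v} [Field Fs] [Algebra F Fs] [IsSepClosure F Fs]
  {P : PlaceExtension F Fs} (hF : IsGlobalField F) {M₁ M M₂ N₁ : SMod.{u, v, w} P}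

variable (M N₁) in
/-- The product of two Selmerable modules. -/
noncomputable def prodObject : SMod.{u, v, w} P :=
  pullbackObject (0 : M ⟶ zeroObject P) (0 : N₁ ⟶ zeroObject P) hF

namespace prodObject

/-- The first projection. -/
noncomputable def fst : prodObject hF M N₁ ⟶ M := pullbackObject.fst _ _ _

/-- The second projection. -/
noncomputable def snd : prodObject hF M N₁ ⟶ N₁ := pullbackObject.snd _ _ _

/-- The morphism to the product with given components. -/
noncomputable def lift (f : M₁ ⟶ M) (g : M₁ ⟶ N₁) : M₁ ⟶ prodObject hF M N₁ :=
  pullbackObject.lift hF f g (by rw [comp_zero, comp_zero])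

theorem lift_fst (f : M₁ ⟶ M) (g : M₁ ⟶ N₁) : lift hF f g ≫ fst hF = f := rfl

theorem lift_snd (f : M₁ ⟶ M) (g : M₁ ⟶ N₁) : lift hF f g ≫ snd hF = g := rfl

variable {hF} in
theorem ext {x y : (prodObject hF M N₁).carrier} (h1 : (fst hF).hom x = (fst hF).hom y)
    (h2 : (snd hF).hom x = (snd hF).hom y) : x = y :=
  PullbackModule.ext h1 h2

theorem hom_ext {f g : M₂ ⟶ prodObject hF M N₁} (h1 : f ≫ fst hF = g ≫ fst hF)
    (h2 : f ≫ snd hF = g ≫ snd hF) : f = g :=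
  SMod.hom_ext fun x => ext (hom_congr h1 x) (hom_congr h2 x)

end prodObject

section Pushout

open prodObject

variable (ι : M₁ ⟶ M) (g : M₁ ⟶ N₁)

/-- The amalgamated sum of Selmerable modules. -/
noncomputable def pushoutObject : SMod.{u, v, w} P := cokernelObject hF (lift hF ι (-g))

namespace pushoutObject

/-- The projection from the product. -/
noncomputable def mk : prodObject hF M N₁ ⟶ pushoutObject hF ι g := cokernelObject.mk hF _

theorem strictSurj_mk : StrictSurj (mk hF ι g) := cokernelObject.strictSurj_mk hF _

/-- The first coprojection. -/
noncomputable def inl : M ⟶ pushoutObject hF ι g := lift hF (𝟙 M) 0 ≫ mk hF ι g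

/-- The second coprojection. -/
noncomputable def inr : N₁ ⟶ pushoutObject hF ι g := lift hF 0 (𝟙 N₁) ≫ mk hF ι g

theorem lift_mk : lift hF ι (-g) ≫ mk hF ι g = 0 := cokernelObject.comp_mk hF _

variable {hF ι g} in
theorem mk_hom_eq_zero_iff {x : (prodObject hF M N₁).carrier} :
    (mk hF ι g).hom x = 0 ↔ ∃ y, (lift hF ι (-g)).hom y = x :=
  cokernelObject.mk_hom_eq_zero_iff

theorem fst_inl_add_snd_inr : fst hF ≫ inl hF ι g + snd hF ≫ inr hF ι g = mk hF ι g := by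
  have : fst hF ≫ lift hF (𝟙 M) 0 + snd hF ≫ lift hF 0 (𝟙 N₁) = 𝟙 (prodObject hF M N₁) := by
    apply prodObject.hom_ext <;>
      simp only [Preadditive.add_comp, Category.assoc, lift_fst, lift_snd, Category.comp_id,
        Category.id_comp, comp_zero, add_zero, zero_add]
  rw [inl, inr, ← Category.assoc, ← Category.assoc, ← Preadditive.add_comp, this,
    Category.id_comp]

theorem condition : ι ≫ inl hF ι g = g ≫ inr hF ι g := by
  have := lift_mk hF ι g
  rw [← fst_inl_add_snd_inr, Preadditive.comp_add, ← Category.assoc, ← Category.assoc, lift_fst,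
    lift_snd, Preadditive.neg_comp, add_neg_eq_zero] at this
  exact this

variable {ι g} in
/-- The morphism from the amalgamated sum given by two compatible morphisms. -/
noncomputable def desc (a : M ⟶ M₂) (b : N₁ ⟶ M₂) (h : ι ≫ a = g ≫ b) :
    pushoutObject hF ι g ⟶ M₂ :=
  (strictSurj_mk hF ι g).desc (fst hF ≫ a + snd hF ≫ b) fun x hx => by
    obtain ⟨y, rfl⟩ := mk_hom_eq_zero_iff.mp hx
    rw [← comp_hom_apply, Preadditive.comp_add, ← Category.assoc, ← Category.assoc, lift_fst,
      lift_snd, Preadditive.neg_comp, h, add_neg_cancel, zero_hom_apply]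

variable {ι g} in
theorem mk_desc (a : M ⟶ M₂) (b : N₁ ⟶ M₂) (h : ι ≫ a = g ≫ b) :
    mk hF ι g ≫ desc hF a b h = fst hF ≫ a + snd hF ≫ b :=
  StrictSurj.comp_desc _ _ _

variable {ι g} in
theorem inl_desc (a : M ⟶ M₂) (b : N₁ ⟶ M₂) (h : ι ≫ a = g ≫ b) :
    inl hF ι g ≫ desc hF a b h = a := by
  rw [inl, Category.assoc, mk_desc, Preadditive.comp_add, ← Category.assoc, ← Category.assoc,
    lift_fst, lift_snd, Category.id_comp, zero_comp, add_zero]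

variable {ι g} in
theorem inr_desc (a : M ⟶ M₂) (b : N₁ ⟶ M₂) (h : ι ≫ a = g ≫ b) :
    inr hF ι g ≫ desc hF a b h = b := by
  rw [inr, Category.assoc, mk_desc, Preadditive.comp_add, ← Category.assoc, ← Category.assoc,
    lift_fst, lift_snd, Category.id_comp, zero_comp, zero_add]

theorem isPushout : IsPushout ι g (inl hF ι g) (inr hF ι g) where
  w := condition hF ι g
  isColimit' := ⟨PushoutCocone.IsColimit.mk _ (fun s => desc hF s.inl s.inr s.condition)
    (fun _ => inl_desc _ _ _ _) (fun _ => inr_desc _ _ _ _) (fun s m h1 h2 => by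
      have := (strictSurj_mk hF ι g).epi
      rw [← cancel_epi (mk hF ι g), mk_desc, ← fst_inl_add_snd_inr, Preadditive.add_comp,
        Category.assoc, Category.assoc, h1, h2])⟩

end pushoutObject

end Pushout

section PushoutExact

open prodObject

variable {ι : M₁ ⟶ M} {π : M ⟶ M₂}

theorem ShortExact.pushoutObject (h : ShortExact ι π) (g : M₁ ⟶ N₁) :
    ShortExact (pushoutObject.inr hF ι g)
      (pushoutObject.desc hF π (0 : N₁ ⟶ M₂) (by rw [h.zero, comp_zero])) where
  injective := (injective_iff_map_eq_zero _).mpr fun n hn => by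
    obtain ⟨m, hm⟩ := pushoutObject.mk_hom_eq_zero_iff.mp hn
    have h1 : ι.hom m = 0 := congrArg (fst hF).hom hm
    have h2 : -g.hom m = n := congrArg (snd hF).hom hm
    rw [← h2, h.injective (h1.trans (map_zero _).symm), map_zero, neg_zero]
  exact x := by
    constructor
    · intro hx
      obtain ⟨y, rfl⟩ := (pushoutObject.strictSurj_mk hF ι g).surjective x
      rw [← comp_hom_apply, pushoutObject.mk_desc, comp_zero, add_zero, comp_hom_apply,
        h.exact] at hx
      obtain ⟨m, hm⟩ := hx
      refine ⟨(snd hF).hom y + g.hom m, ?_⟩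
      rw [← hom_congr (pushoutObject.fst_inl_add_snd_inr hF ι g) y, add_hom_apply, comp_hom_apply,
        comp_hom_apply, ← hm, ← comp_hom_apply, pushoutObject.condition, map_add, add_comm]
      rfl
    · rintro ⟨n, rfl⟩
      rw [← comp_hom_apply, pushoutObject.inr_desc, zero_hom_apply]
  surjective y := by
    obtain ⟨m, rfl⟩ := h.surjective y
    exact ⟨(pushoutObject.inl hF ι g).hom m, by rw [← comp_hom_apply, pushoutObject.inl_desc]⟩
  comap_W := by
    ext φ
    refine ⟨fun hφ => ?_, fun hφ => AddSubgroup.mem_comap.mpr (locMap_mem _ hφ)⟩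
    rw [AddSubgroup.mem_comap, ← (pushoutObject.strictSurj_mk hF ι g).map_W] at hφ
    obtain ⟨ψ, hψ, hψφ⟩ := hφ
    -- The class of (0, φ) and its lift ψ satisfying the local conditions have the same image in the
    -- pushout, so their difference comes from a class a on M₁. The first component puts a in M₁.W,
    -- because ι is strict; the second then exhibits φ as an element of N₁.W.
    have hzero : locMap (pushoutObject.mk hF ι g)
        (locMap (lift hF (0 : N₁ ⟶ M) (𝟙 N₁)) φ - ψ) = 0 := by
      rw [map_sub, hψφ, ← locMap_comp]
      exact sub_self _
    have hinj : Function.Injective (lift hF ι (-g)).hom := fun x y hxy =>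
      h.injective (congrArg (fst hF).hom hxy)
    obtain ⟨a, ha⟩ := exists_localMap_eq_of_localMap_eq_zero P hF _ (lift hF ι (-g)).map_smul hinj
      _ (pushoutObject.mk hF ι g).map_smul (pushoutObject.strictSurj_mk hF ι g).surjective
      (fun m hm => pushoutObject.mk_hom_eq_zero_iff.mp hm) hzero
    replace ha : locMap (lift hF ι (-g)) a =
      locMap (lift hF (0 : N₁ ⟶ M) (𝟙 N₁)) φ - ψ := ha
    have h1 := congrArg (locMap (fst hF)) ha
    have h2 := congrArg (locMap (snd hF)) ha
    rw [map_sub, ← locMap_comp, ← locMap_comp, lift_fst, lift_fst, locMap_zero, zero_sub] at h1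
    rw [map_sub, ← locMap_comp, ← locMap_comp, lift_snd, lift_snd, locMap_id,
      eq_sub_iff_add_eq] at h2
    have ha' : a ∈ M₁.W := by
      rw [← h.comap_W, AddSubgroup.mem_comap, h1]
      exact neg_mem (locMap_mem _ hψ)
    rw [← h2]
    exact add_mem (locMap_mem _ ha') (locMap_mem _ hψ)
  map_W := by
    ext φ
    constructor
    · rintro ⟨ψ, hψ, rfl⟩
      exact locMap_mem _ hψ
    · intro hφ
      rw [← h.map_W] at hφ
      obtain ⟨ψ, hψ, rfl⟩ := hφ
      refine ⟨locMap (pushoutObject.inl hF ι g) ψ, locMap_mem _ hψ, ?_⟩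
      rw [← locMap_comp, pushoutObject.inl_desc]

theorem ShortExact.of_isPushout (hF : IsGlobalField F) (h : ShortExact ι π)
    {N : SMod.{u, v, w} P} {g : M₁ ⟶ N₁} {q : M ⟶ N} {ιN : N₁ ⟶ N} (hN : IsPushout ι g q ιN)
    {πN : N ⟶ M₂} (h1 : q ≫ πN = π) (h2 : ιN ≫ πN = 0) : ShortExact ιN πN := by
  have hN' := pushoutObject.isPushout hF ι g
  refine (h.pushoutObject hF g).of_iso (hN.isoIsPushout _ _ hN')
    (hN.inr_isoIsPushout_hom _ _ hN') ?_
  apply hN.hom_ext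
  · rw [← Category.assoc, hN.inl_isoIsPushout_hom, h1, pushoutObject.inl_desc]
  · rw [← Category.assoc, hN.inr_isoIsPushout_hom, h2, pushoutObject.inr_desc]

end PushoutExact

/-- Every strict epimorphism or monomorphism completes to a short exact sequence; the pulled back or
pushed out sequence is again short exact, so the new map is strict. -/
theorem isQuasiAbelian (hF : IsGlobalField F) : IsQuasiAbelian (SMod.{u, v, w} P) where
  hasFiniteBiproducts := hasFiniteBiproducts hF
  hasKernels := hasKernels hF
  hasCokernels := hasCokernels hF
  isStrictEpi_of_isPullback p f' f g hp hf := by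
    have h := ((isStrictEpi_iff_strictSurj hF).mp hf).shortExact hF
    obtain ⟨i, hi, -⟩ := h.existsUnique_of_isPullback hp
    exact (h.of_isPullback hF hp hi.1 hi.2).isStrictEpi
  isStrictMono_of_isPushout f g q f' hp hf := by
    have h := ((isStrictMono_iff_strictInj hF).mp hf).shortExact hF
    obtain ⟨i, hi, -⟩ := h.existsUnique_of_isPushout hp
    exact (h.of_isPushout hF hp hi.1 hi.2).isStrictMono

end SMod

end Selmerable

theorem mainTheorem8 {F : Type u} [Field F] (hF : Selmerable.IsGlobalField F)
    {Fs : Type v} [Field Fs] [Algebra F Fs] [IsSepClosure F Fs]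
    (P : Selmerable.PlaceExtension F Fs) :
    Selmerable.IsQuasiAbelian (Selmerable.SMod.{u, v, w} P) ∧
    ∀ {M₁ M M₂ : Selmerable.SMod.{u, v, w} P} (ι : M₁ ⟶ M) (π : M ⟶ M₂),
      Selmerable.SMod.ShortExact ι π →
      (∀ {N₂ : Selmerable.SMod.{u, v, w} P} (f : N₂ ⟶ M₂),
        HasPullback π f ∧
        ∀ {N : Selmerable.SMod.{u, v, w} P} (p : N ⟶ M) (πN : N ⟶ N₂), IsPullback p πN π f →
          (∃! ιN : M₁ ⟶ N, ιN ≫ p = ι ∧ ιN ≫ πN = 0) ∧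
          ∀ ιN : M₁ ⟶ N, ιN ≫ p = ι → ιN ≫ πN = 0 → Selmerable.SMod.ShortExact ιN πN) ∧
      (∀ {N₁ : Selmerable.SMod.{u, v, w} P} (g : M₁ ⟶ N₁),
        HasPushout ι g ∧
        ∀ {N : Selmerable.SMod.{u, v, w} P} (q : M ⟶ N) (ιN : N₁ ⟶ N), IsPushout ι g q ιN →
          (∃! πN : N ⟶ M₂, q ≫ πN = π ∧ ιN ≫ πN = 0) ∧
          ∀ πN : N ⟶ M₂, q ≫ πN = π → ιN ≫ πN = 0 → Selmerable.SMod.ShortExact ιN πN) :=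
  ⟨Selmerable.SMod.isQuasiAbelian hF, fun ι π h =>
    ⟨fun f => ⟨(Selmerable.SMod.pullbackObject.isPullback π f hF).hasPullback, fun _ _ hN =>
      ⟨h.existsUnique_of_isPullback hN, fun _ h1 h2 => h.of_isPullback hF hN h1 h2⟩⟩,
    fun g => ⟨(Selmerable.SMod.pushoutObject.isPushout hF ι g).hasPushout, fun _ _ hN =>
      ⟨h.existsUnique_of_isPushout hN, fun _ h1 h2 => h.of_isPushout hF hN h1 h2⟩⟩⟩⟩
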